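/- Theorem 3.1. Let $p\neq q$ be primes, let $v\ge 1$ be an integer, and let $u$ be the order of $p$ in the group of units of $\mathbb{Z}/q\mathbb{Z}$. A Schmidt group is a non-nilpotent finite group all of whose proper subgroups are nilpotent; it has parameters $p,q,v$ if its derived subgroup $G'$ is a $p$-group and $G=G'\rtimes\langle b\rangle$ (internal semidirect product) for some element $b$ of order $q^v$. For a group $G$, let $\mathrm{End}(G)$ be its endomorphism semigroup, where $xy$ means first $x$, then $y$; let $0$ be the endomorphism with trivial image and $1$ the identity map. Let $I_0(G)$ be the set of idempotents of $\mathrm{End}(G)$ other than $0$ and $1$. For $x\in\mathrm{End}(G)$ put $$[x]=\{y\in\mathrm{End}(G): y^2=y,\ xy=y,\ yx=x\},\qquad K_G(x)=\{y\in\mathrm{End}(G): yx=xy=y\},$$ $$H_G(x)=\{y\in\mathrm{End}(G): xy=y,\ yx=0\},\qquad V_G(x)=\{y\in\mathrm{Aut}(G): yx=x\},\qquad D_G(x)=\{y\in\mathrm{Aut}(G): yx=xy=x\}.$$ Let $G$ be a finite group. Then $G$ is isomorphic to a Schmidt group with parameters $p,q,v$ if and only if there exists $x\in I_0(G)$ such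 that 1. $K_G(x)\cong\mathrm{End}(C(q^v))$ as semigroups, where $C(q^v)$ is the cyclic group of order $q^v$; 2. $H_G(x)=\{0\}$; 3. $I_0(G)=[x]$; 4. $|I_0(G)|=p^u$; 5. $\mathrm{End}(G)\setminus\mathrm{Aut}(G)=\bigcup_{y\in I_0(G)}K_G(y)$; 6. for every $z\in\mathrm{End}(G)$: $z\in\bigcap_{y\in I_0(G)}K_G(y)$ if and only if $z^v=0$; 7. $D_G(x)$ is a $p'$-subgroup of $V_G(x)$, that is, a subgroup of order not divisible by $p$; 8. each Sylow $p$-subgroup of $V_G(x)$ is an elementary abelian group of order $p^u$. -/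

import Mathlib

/-!
Products in `Monoid.End G` and `MulAut G` are Mathlib's, so `x * y = x ∘ y` (first `y`, then `x`).
When maps are written to the right of their arguments, the product `xy` (first `x`, then `y`)
is `y * x` below. The doc comments use the right-hand convention, the code uses Mathlib's.
-/

namespace SchmidtEnd

/-- A Schmidt group: a non-nilpotent finite group all of whose proper subgroups are nilpotent. -/
def IsSchmidtGroup (G : Type*) [Group G] : Prop :=
  Finite G ∧ ¬ Group.IsNilpotent G ∧ ∀ H : Subgroup G, H ≠ ⊤ → Group.IsNilpotent H

/-- A Schmidt group with parameters `p, q, v`: `p` and `q` are different primes, `1 ≤ v`, the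
derived subgroup `G'` is a `p`-group, and `G` is the internal semidirect product of `G'` and a
cyclic subgroup `⟨b⟩` of order `q ^ v`. -/
def IsSchmidtGroupWithParams (p q v : ℕ) (G : Type*) [Group G] : Prop :=
  IsSchmidtGroup G ∧ p.Prime ∧ q.Prime ∧ p ≠ q ∧ 1 ≤ v ∧
    IsPGroup p (commutator G) ∧
    ∃ b : G, orderOf b = q ^ v ∧ (commutator G).IsComplement' (Subgroup.zpowers b)

section

variable {G : Type*} [Group G]

/-- The zero of `End(G)`: the endomorphism sending everything to the identity element. -/
def zeroEnd (G : Type*) [Group G] : Monoid.End G := (1 : G →* G)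

/-- An automorphism regarded as an endomorphism. -/
def autToEnd (y : MulAut G) : Monoid.End G := y.toMonoidHom

/-- `Aut(G)` as a subset of `End(G)`. -/
def autSet (G : Type*) [Group G] : Set (Monoid.End G) := Set.range (autToEnd (G := G))

/-- `I₀(G)`: the idempotents of `End(G)` different from `0` and `1`. -/
def I₀ (G : Type*) [Group G] : Set (Monoid.End G) :=
  {x | IsIdempotentElem x ∧ x ≠ zeroEnd G ∧ x ≠ 1}

/-- `[x] = {y ∈ End(G) | y² = y, xy = y, yx = x}`. -/
def idemClass (x : Monoid.End G) : Set (Monoid.End G) :=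
  {y | IsIdempotentElem y ∧ y * x = y ∧ x * y = x}

/-- The semigroup `K_G(x) = {y ∈ End(G) | yx = xy = y}`. -/
def K (x : Monoid.End G) : Subsemigroup (Monoid.End G) where
  carrier := {y | x * y = y ∧ y * x = y}
  mul_mem' := by
    rintro a b ⟨ha, _⟩ ⟨_, hb⟩
    exact ⟨by rw [← mul_assoc, ha], by rw [mul_assoc, hb]⟩

/-- `H_G(x) = {y ∈ End(G) | xy = y, yx = 0}`. -/
def H (x : Monoid.End G) : Set (Monoid.End G) :=
  {y | y * x = y ∧ x * y = zeroEnd G}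

/-- The subgroup `V_G(x) = {y ∈ Aut(G) | yx = x}` of `Aut(G)`. -/
def V (x : Monoid.End G) : Subgroup (MulAut G) where
  carrier := {y | x * autToEnd y = x}
  one_mem' := rfl
  mul_mem' := by
    intro a b ha hb
    have h : x * (autToEnd a * autToEnd b) = x := by
      rw [← mul_assoc, Set.mem_ofPred.mp ha, Set.mem_ofPred.mp hb]
    exact h
  inv_mem' := by
    intro a ha
    have h : autToEnd a * autToEnd a⁻¹ = 1 := Monoid.End.ext G fun g => a.apply_symm_apply g
    have h2 : x * autToEnd a * autToEnd a⁻¹ = x := by rw [mul_assoc, h, mul_one]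
    rw [Set.mem_ofPred.mp ha] at h2
    exact h2

/-- The subgroup `D_G(x) = {y ∈ Aut(G) | yx = xy = x}` of `Aut(G)`. -/
def D (x : Monoid.End G) : Subgroup (MulAut G) where
  carrier := {y | x * autToEnd y = x ∧ autToEnd y * x = x}
  one_mem' := ⟨rfl, rfl⟩
  mul_mem' := by
    rintro a b ⟨ha, ha'⟩ ⟨hb, hb'⟩
    refine ⟨(V x).mul_mem ha hb, ?_⟩
    have h : (autToEnd a * autToEnd b) * x = x := by rw [mul_assoc, hb', ha']
    exact h
  inv_mem' := by
    rintro a ⟨ha, ha'⟩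
    refine ⟨(V x).inv_mem ha, ?_⟩
    have h : autToEnd a⁻¹ * autToEnd a = 1 := Monoid.End.ext G fun g => a.symm_apply_apply g
    have h2 : autToEnd a⁻¹ * (autToEnd a * x) = x := by rw [← mul_assoc, h, one_mul]
    rw [ha'] at h2
    exact h2

end

/-- An elementary abelian `p`-group: an abelian group in which every element satisfies
`a ^ p = 1`. -/
def IsElementaryAbelian (p : ℕ) (A : Type*) [Group A] : Prop :=
  (∀ a b : A, a * b = b * a) ∧ ∀ a : A, a ^ p = 1

end SchmidtEnd

-- Let `N` be the kernel of `x` and `b` a generator of its image. Both directions work in `G = N ⋊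
-- ⟨b⟩` with `⟨b⟩` a cyclic Sylow `q`-subgroup (`IsCoprimeRetraction`). There an endomorphism
-- killing `N` is determined by its value at `b`, and `[x]` corresponds to the conjugacy class of
-- `b`.
--
-- In a Schmidt group `N = G'`, and `b` centralizes every proper subgroup of `N` that it normalizes,
-- because `P⟨b⟩` is then nilpotent (`commute_of_ne`). It follows that `C_N(b) = N ∩ Z(G)` and that
-- `N / C_N(b)` is an irreducible `𝔽_p⟨b⟩`-module on which `b ^ q` acts trivially. Its order, which
-- is the size of the class of `b`, is at most `p ^ u` by irreducibility
-- (`natCard_le_of_irreducible`) and at least `p ^ u` because it is `1` modulo `q`. Endomorphisms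
-- that are not automorphisms kill `N`, so the conditions on them concern only the conjugates of
-- `⟨b⟩`. Finally `V x` is transitive on the class of `b` with stabilizer `D x`, and an element of
-- order `p` in `D x` would act trivially on the module, then on `N`.
--
-- Conversely, the conditions on `K` and `H` make `⟨b⟩` a cyclic Sylow `q`-subgroup, and those on
-- `I₀` give `b` exactly `p ^ u` conjugates. A Frattini argument yields a Sylow `p`-subgroup `P`
-- normalized by `b`. The order of the Sylow subgroups of `V x` forces `C_P(b) = P ∩ Z(G)` and makes
-- `P` transitive on the class of `b`; a count then shows that `P` is normal. A nontrivial
-- complement of `P⟨b⟩` would give an idempotent outside `[x]`, so `G = P⟨b⟩` and `P = N`. The last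
-- two conditions on endomorphisms give `N = G'` and `b ^ q ∈ Z(G)`. In a proper subgroup containing
-- `b`, the orbit of `b` under the `p`-part has size a power of `p ^ u`, and only size `1` is
-- possible; this gives nilpotence.

universe u

section

open Subgroup

/-! ### Nilpotence, and recognizing a cyclic `q`-group from its endomorphisms -/

/-- A finite group in which some `p`-power of every element is central is nilpotent. -/
theorem Group.isNilpotent_of_pow_mem_center {H : Type*} [Group H] [Finite H] {p : ℕ}
    (hp : p.Prime) (h : ∀ g : H, ∃ m : ℕ, g ^ p ^ m ∈ center H) : Group.IsNilpotent H := by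
  have : Fact p.Prime := ⟨hp⟩
  refine Group.of_quotient_center_nilpotent (IsPGroup.isNilpotent (p := p) ?_)
  intro g
  induction g using QuotientGroup.induction_on with
  | H g =>
    obtain ⟨m, hm⟩ := h g
    exact ⟨m, by rw [← QuotientGroup.mk_pow]; exact (QuotientGroup.eq_one_iff _).2 hm⟩

/-- Sylow subgroups are normal, and those for different primes are disjoint. The nilpotence of the
proper subgroups of a Schmidt group enters only through this lemma. -/
theorem Group.IsNilpotent.commute_of_pow_eq_one {H : Type*} [Group H] [Finite H]
    (hH : Group.IsNilpotent H) {p q : ℕ} (hp : p.Prime) (hq : q.Prime) (hpq : p ≠ q) {a b : H}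
    {m n : ℕ} (ha : a ^ p ^ m = 1) (hb : b ^ q ^ n = 1) : a * b = b * a := by
  have : Fact p.Prime := ⟨hp⟩
  have : Fact q.Prime := ⟨hq⟩
  have hn := (Group.isNilpotent_of_finite_tfae (G := H)).out 0 3 |>.mp hH
  have hA : IsPGroup p (zpowers a) := by
    obtain ⟨k, -, hk⟩ := (Nat.dvd_prime_pow hp).1 (orderOf_dvd_of_pow_eq_one ha)
    exact IsPGroup.of_card (n := k) (by rw [Nat.card_zpowers, hk])
  have hB : IsPGroup q (zpowers b) := by
    obtain ⟨k, -, hk⟩ := (Nat.dvd_prime_pow hq).1 (orderOf_dvd_of_pow_eq_one hb)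
    exact IsPGroup.of_card (n := k) (by rw [Nat.card_zpowers, hk])
  obtain ⟨P, hP⟩ := hA.exists_le_sylow
  obtain ⟨Q, hQ⟩ := hB.exists_le_sylow
  refine Subgroup.commute_of_normal_of_disjoint _ _ (hn p ⟨hp⟩ P) (hn q ⟨hq⟩ Q) ?_ a b
    (hP (mem_zpowers a)) (hQ (mem_zpowers b))
  exact IsPGroup.disjoint_of_ne p q hpq _ _ P.2 Q.2

/-- A normal maximal subgroup of a finite group is the kernel of an endomorphism with cyclic
image. -/
theorem exists_end_ker_eq_of_isCoatom {Q : Type*} [Group Q] [Finite Q] {M : Subgroup Q}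
    [M.Normal] (hM : IsCoatom M) : ∃ (f : Q →* Q) (z : Q), f.ker = M ∧ f.range ≤ zpowers z := by
  obtain ⟨g, -, hg⟩ := SetLike.exists_of_lt hM.lt_top
  have hgen : ∀ y : Q ⧸ M, y ∈ zpowers (g : Q ⧸ M) := by
    have h : (zpowers (g : Q ⧸ M)).comap (QuotientGroup.mk' M) = ⊤ := by
      refine hM.2 _ (lt_of_le_of_ne ?_ ?_)
      · intro m hm
        rw [mem_comap, QuotientGroup.mk'_apply, (QuotientGroup.eq_one_iff m).2 hm]
        exact one_mem _
      · intro h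
        apply hg
        rw [h, mem_comap]
        exact mem_zpowers _
    intro y
    induction y using QuotientGroup.induction_on with
    | H y => exact mem_comap.1 (h ▸ mem_top y)
  have hg1 : (g : Q ⧸ M) ≠ 1 := fun h => hg ((QuotientGroup.eq_one_iff g).1 h)
  -- By Cauchy `Q` has an element `z` of order `r`. The kernel of the map induced by `g ↦ z`
  -- contains `M` but not `g`, so it equals `M` by maximality.
  obtain ⟨r, hr, hrd⟩ := Nat.exists_prime_and_dvd (n := orderOf (g : Q ⧸ M))
    (fun h => hg1 (orderOf_eq_one_iff.1 h))
  have : Fact r.Prime := ⟨hr⟩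
  obtain ⟨z, hz⟩ := exists_prime_orderOf_dvd_card' (G := Q) r
    (hrd.trans ((orderOf_map_dvd (QuotientGroup.mk' M) g).trans (orderOf_dvd_natCard g)))
  let φ := monoidHomOfForallMemZpowers hgen (g' := z) (hz ▸ hrd)
  have hφ : φ g = z := monoidHomOfForallMemZpowers_apply_gen hgen _
  refine ⟨φ.comp (QuotientGroup.mk' M), z, ?_, ?_⟩
  · by_contra hne
    have h := hM.2 _ (lt_of_le_of_ne (a := M) (b := (φ.comp (QuotientGroup.mk' M)).ker) ?_
      (Ne.symm hne))
    · have : g ∈ (φ.comp (QuotientGroup.mk' M)).ker := h ▸ mem_top g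
      rw [MonoidHom.mem_ker, MonoidHom.comp_apply, QuotientGroup.mk'_apply, hφ] at this
      rw [this, orderOf_one] at hz
      exact hr.one_lt.ne hz
    · intro m hm
      rw [MonoidHom.mem_ker, MonoidHom.comp_apply, QuotientGroup.mk'_apply,
        (QuotientGroup.eq_one_iff m).2 hm, map_one]
  · rintro _ ⟨y, rfl⟩
    obtain ⟨k, hk⟩ := mem_zpowers_iff.1 (hgen y)
    refine mem_zpowers_iff.2 ⟨k, ?_⟩
    rw [MonoidHom.comp_apply, QuotientGroup.mk'_apply, ← hk, map_zpow, hφ]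

theorem exists_coatom_of_ne_top {Q : Type*} [Group Q] [Finite Q] {M : Subgroup Q} (h : M ≠ ⊤) :
    ∃ L, IsCoatom L ∧ M ≤ L :=
  (eq_top_or_exists_le_coatom M).resolve_left h

/-- A finite group with at most one maximal subgroup is cyclic. -/
theorem isCyclic_of_isCoatom_unique {Q : Type*} [Group Q] [Finite Q]
    (h : ∀ M₁ M₂ : Subgroup Q, IsCoatom M₁ → IsCoatom M₂ → M₁ = M₂) : IsCyclic Q := by
  by_contra hc
  have hz : ∀ g : Q, zpowers g ≠ ⊤ := fun g hg =>
    hc ⟨g, fun y => mem_zpowers_iff.1 (hg ▸ mem_top y)⟩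
  obtain ⟨M, hM, -⟩ := exists_coatom_of_ne_top (hz 1)
  refine hM.1 (eq_top_iff.2 fun g _ => ?_)
  obtain ⟨L, hL, hgL⟩ := exists_coatom_of_ne_top (hz g)
  rw [h M L hM hL]
  exact hgL (mem_zpowers g)

/-- The endomorphisms of a finite cyclic group are determined by the image of a generator. -/
theorem IsCyclic.natCard_monoidEnd (C : Type*) [Group C] [IsCyclic C] :
    Nat.card (Monoid.End C) = Nat.card C := by
  obtain ⟨c, hc⟩ := IsCyclic.exists_generator (α := C)
  refine Nat.card_congr (Equiv.ofBijective (fun f : Monoid.End C => f c) ⟨?_, ?_⟩)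
  · intro f g hfg
    refine Monoid.End.ext _ fun y => ?_
    obtain ⟨k, rfl⟩ := mem_zpowers_iff.1 (hc y)
    rw [map_zpow, map_zpow]
    exact congrArg (· ^ k) hfg
  · intro d
    have hd : orderOf d ∣ orderOf c := by
      rw [orderOf_eq_card_of_forall_mem_zpowers hc]
      exact orderOf_dvd_natCard d
    exact ⟨monoidHomOfForallMemZpowers hc hd, monoidHomOfForallMemZpowers_apply_gen hc hd⟩

theorem IsCyclic.monoidEnd_mul_comm {C : Type*} [Group C] [IsCyclic C] (f g : Monoid.End C) :
    f * g = g * f := by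
  obtain ⟨c, hc⟩ := IsCyclic.exists_generator (α := C)
  obtain ⟨m, hm⟩ := mem_zpowers_iff.1 (hc (f c))
  obtain ⟨n, hn⟩ := mem_zpowers_iff.1 (hc (g c))
  refine Monoid.End.ext _ fun y => ?_
  obtain ⟨k, rfl⟩ := mem_zpowers_iff.1 (hc y)
  have : f (g c) = g (f c) := by
    rw [← hm, ← hn, map_zpow, map_zpow, ← hm, ← hn, ← zpow_mul, ← zpow_mul, mul_comm]
  rw [map_zpow, map_zpow]
  exact congrArg (· ^ k) this

/-- In the endomorphism semigroup of a cyclic `q`-group, divisibility is a total relation. -/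
theorem IsCyclic.monoidEnd_dvd_total {C : Type*} [Group C] [IsCyclic C] {q v : ℕ} (hq : q.Prime)
    (hC : Nat.card C = q ^ v) (f g : Monoid.End C) : (∃ h, f = h * g) ∨ ∃ h, g = h * f := by
  obtain ⟨c, hc⟩ := IsCyclic.exists_generator (α := C)
  have hord : orderOf c = q ^ v := by rw [orderOf_eq_card_of_forall_mem_zpowers hc, hC]
  -- Here `f` and `g` are the `m`-th and `n`-th power maps, and Bézout solves `m ≡ r t n` modulo `q
  -- ^ v`. Both gcds are powers of `q`, hence comparable.
  have key : ∀ (f g : Monoid.End C) (m n : ℤ), c ^ m = f c → c ^ n = g c →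
      Int.gcd n (q ^ v : ℕ) ∣ Int.gcd m (q ^ v : ℕ) → ∃ h, f = h * g := by
    intro f g m n hm hn hd
    have hd' : ((Int.gcd n (q ^ v : ℕ) : ℕ) : ℤ) ∣ m :=
      (Int.natCast_dvd_natCast.2 hd).trans (Int.gcd_dvd_left ..)
    obtain ⟨t, ht⟩ := hd'
    rw [Int.gcd_eq_gcd_ab] at ht
    set r := Int.gcdA n (q ^ v : ℕ)
    set s := Int.gcdB n (q ^ v : ℕ)
    have hd : orderOf (c ^ (r * t)) ∣ orderOf c := by
      rw [orderOf_eq_card_of_forall_mem_zpowers hc]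
      exact orderOf_dvd_natCard _
    let h : Monoid.End C := monoidHomOfForallMemZpowers hc hd
    have hh : h c = c ^ (r * t) := monoidHomOfForallMemZpowers_apply_gen hc hd
    refine ⟨h, MonoidHom.ext fun y => ?_⟩
    obtain ⟨k, rfl⟩ := mem_zpowers_iff.1 (hc y)
    suffices f c = h (g c) from
      (map_zpow f c k).trans ((congrArg (· ^ k) this).trans (map_zpow (h * g) c k).symm)
    have h1 : c ^ ((q ^ v : ℕ) : ℤ) = 1 := by rw [zpow_natCast, ← hord, pow_orderOf_eq_one]
    rw [← hn, map_zpow, hh, ← hm, ht, add_mul, zpow_add, mul_assoc ((q ^ v : ℕ) : ℤ), zpow_mul c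
      ((q ^ v : ℕ) : ℤ), h1, one_zpow, mul_one, ← zpow_mul]
    congr 1
    ring
  obtain ⟨m, hm⟩ := mem_zpowers_iff.1 (hc (f c))
  obtain ⟨n, hn⟩ := mem_zpowers_iff.1 (hc (g c))
  obtain ⟨i, -, hi⟩ := (Nat.dvd_prime_pow hq).1
    (Int.natCast_dvd_natCast.1 (Int.gcd_dvd_right m ((q ^ v : ℕ) : ℤ)))
  obtain ⟨j, -, hj⟩ := (Nat.dvd_prime_pow hq).1
    (Int.natCast_dvd_natCast.1 (Int.gcd_dvd_right n ((q ^ v : ℕ) : ℤ)))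
  rcases le_total i j with hij | hij
  · exact Or.inr (key g f n m hn hm (by rw [hi, hj]; exact pow_dvd_pow q hij))
  · exact Or.inl (key f g m n hm hn (by rw [hi, hj]; exact pow_dvd_pow q hij))

/-- Inner automorphisms commute, so commutators are central and the class is at most two. -/
theorem Group.isNilpotent_of_monoidEnd_mul_comm {Q : Type*} [Group Q]
    (h : ∀ f g : Monoid.End Q, f * g = g * f) : Group.IsNilpotent Q := by
  have hc : ∀ a b : Q, a * b * a⁻¹ * b⁻¹ ∈ center Q := by
    intro a b
    rw [mem_center_iff]
    intro g
    have h1 := DFunLike.congr_fun (h (MulAut.conj a).toMonoidHom (MulAut.conj b).toMonoidHom)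
      (a⁻¹ * b⁻¹ * g * b * a)
    have h2 : a * (b * (a⁻¹ * b⁻¹ * g * b * a) * b⁻¹) * a⁻¹ =
      b * (a * (a⁻¹ * b⁻¹ * g * b * a) * a⁻¹) * b⁻¹ := h1
    have h3 : a * (b * (a⁻¹ * b⁻¹ * g * b * a) * b⁻¹) * a⁻¹ = g := by rw [h2]; group
    calc g * (a * b * a⁻¹ * b⁻¹)
        = (a * (b * (a⁻¹ * b⁻¹ * g * b * a) * b⁻¹) * a⁻¹) * (a * b * a⁻¹ * b⁻¹) := by rw [h3]
      _ = _ := by group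
  refine Group.of_quotient_center_nilpotent ?_
  let _ : CommGroup (Q ⧸ center Q) :=
    { mul_comm := by
        intro a b
        induction a using QuotientGroup.induction_on with
        | H a =>
        induction b using QuotientGroup.induction_on with
        | H b =>
        rw [← QuotientGroup.mk_mul, ← QuotientGroup.mk_mul, QuotientGroup.eq]
        have := hc b⁻¹ a⁻¹
        convert this using 1
        group }
  exact CommGroup.isNilpotent

/-- A finite group whose endomorphism semigroup is that of a cyclic `q`-group is cyclic of the same
order. -/
theorem isCyclic_of_monoidEnd_mulEquiv {Q C : Type*} [Group Q] [Finite Q] [Group C] [IsCyclic C]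
    {q v : ℕ} (hq : q.Prime) (hC : Nat.card C = q ^ v) (e : Monoid.End Q ≃* Monoid.End C) :
    IsCyclic Q ∧ Nat.card Q = q ^ v := by
  have hcomm : ∀ f g : Monoid.End Q, f * g = g * f := fun f g => e.injective (by
    rw [map_mul, map_mul, IsCyclic.monoidEnd_mul_comm])
  have htot : ∀ f g : Monoid.End Q, (∃ h, f = h * g) ∨ ∃ h, g = h * f := by
    intro f g
    refine (IsCyclic.monoidEnd_dvd_total hq hC (e f) (e g)).imp ?_ ?_ <;>
    · rintro ⟨h, hh⟩
      exact ⟨e.symm h, e.injective (by simp [hh])⟩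
  have hnil : Group.IsNilpotent Q := Group.isNilpotent_of_monoidEnd_mul_comm hcomm
  have hle : ∀ (M₁ M₂ : Subgroup Q), IsCoatom M₁ → IsCoatom M₂ → M₁ ≤ M₂ → M₁ = M₂ :=
    fun M₁ M₂ h₁ h₂ h => (h₁.le_iff.1 h).elim (fun h' => absurd h' h₂.1) Eq.symm
  have hcyc : IsCyclic Q := by
    -- Maximal subgroups are kernels of endomorphisms, and `f = h * g` gives `ker g ≤ ker f`. So any
    -- two maximal subgroups are comparable, hence equal.
    refine isCyclic_of_isCoatom_unique fun M₁ M₂ h₁ h₂ => ?_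
    have hn₁ : M₁.Normal := Group.normalizerCondition_of_isNilpotent.normal_of_coatom _ h₁
    have hn₂ : M₂.Normal := Group.normalizerCondition_of_isNilpotent.normal_of_coatom _ h₂
    obtain ⟨f₁, -, hf₁, -⟩ := exists_end_ker_eq_of_isCoatom h₁
    obtain ⟨f₂, -, hf₂, -⟩ := exists_end_ker_eq_of_isCoatom h₂
    have aux : ∀ (f g : Q →* Q) (h : Monoid.End Q), (∀ y, f y = h (g y)) →
        g.ker ≤ f.ker := by
      intro f g h hf y hy
      rw [MonoidHom.mem_ker] at hy ⊢
      rw [hf, hy, map_one]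
    rcases htot f₁ f₂ with ⟨h, hh⟩ | ⟨h, hh⟩
    · refine (hle M₂ M₁ h₂ h₁ ?_).symm
      rw [← hf₁, ← hf₂]
      exact aux _ _ h (DFunLike.congr_fun hh)
    · refine hle M₁ M₂ h₁ h₂ ?_
      rw [← hf₁, ← hf₂]
      exact aux _ _ h (DFunLike.congr_fun hh)
  refine ⟨hcyc, ?_⟩
  rw [← IsCyclic.natCard_monoidEnd Q, Nat.card_congr e.toEquiv, IsCyclic.natCard_monoidEnd, hC]

/-- A complemented normal subgroup is the kernel of a retraction onto its complement. -/
theorem Subgroup.IsComplement'.exists_retraction {G : Type*} [Group G] {N L : Subgroup G}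
    [N.Normal] (h : N.IsComplement' L) :
    ∃ e : G →* G, (∀ g, e g = 1 ↔ g ∈ N) ∧ (∀ g, e g ∈ L) ∧ ∀ g ∈ L, e g = g := by
  let ψ : L ≃* G ⧸ N := h.symm.QuotientMulEquiv.symm
  have hψ : ∀ g : L, ψ g = QuotientGroup.mk' N g := fun g => rfl
  refine ⟨(L.subtype.comp ψ.symm.toMonoidHom).comp (QuotientGroup.mk' N), ?_, ?_, ?_⟩
  · intro g
    simp
  · intro g
    exact (ψ.symm (QuotientGroup.mk' N g)).2
  · intro g hg
    have := hψ ⟨g, hg⟩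
    have h2 := ψ.symm_apply_apply ⟨g, hg⟩
    rw [this] at h2
    exact congrArg Subtype.val h2

/-! ### Retractions onto a cyclic Sylow `q`-subgroup -/

namespace SchmidtEnd

section

variable {G : Type*} [Group G]

/-- The kernel of an endomorphism. -/
def endKer (x : Monoid.End G) : Subgroup G := MonoidHom.ker (x : G →* G)

theorem mem_endKer {x : Monoid.End G} {g : G} : g ∈ endKer x ↔ x g = 1 := Iff.rfl

instance (x : Monoid.End G) : (endKer x).Normal := MonoidHom.normal_ker _

theorem end_pow_zpow_apply (z : Monoid.End G) {b : G} {k : ℤ} (h : z b = b ^ k) (m : ℕ) :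
    (z ^ m) b = b ^ k ^ m := by
  induction m with
  | zero => simp
  | succ m ih =>
    have : (z ^ (m + 1)) b = (z ^ m) (z b) := by rw [pow_succ]; rfl
    rw [this, h, map_zpow, ih, ← zpow_mul, pow_succ]

/-- An endomorphism trivial on the kernel of a retraction onto `⟨b⟩` can take any value at `b` whose
order divides that of `b`. -/
theorem exists_end_of_orderOf_dvd {x : Monoid.End G} {b c : G} (hx : ∀ g, x g ∈ zpowers b)
    (hxb : x b = b) (hc : orderOf c ∣ orderOf b) :
    ∃ z : Monoid.End G, endKer x ≤ endKer z ∧ z b = c := by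
  let b' : zpowers b := ⟨b, mem_zpowers b⟩
  have hgen : ∀ y : zpowers b, y ∈ zpowers b' := by
    rintro ⟨y, hy⟩
    obtain ⟨k, rfl⟩ := mem_zpowers_iff.1 hy
    exact mem_zpowers_iff.2 ⟨k, rfl⟩
  have hord : orderOf c ∣ orderOf b' := by rwa [← orderOf_coe]
  let φ : G →* zpowers b := (x : G →* G).codRestrict (zpowers b) hx
  refine ⟨(monoidHomOfForallMemZpowers hgen hord).comp φ, ?_, ?_⟩
  · intro n hn
    have : φ n = 1 := Subtype.ext (mem_endKer.1 hn)
    change monoidHomOfForallMemZpowers hgen hord (φ n) = 1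
    rw [this, map_one]
  · have : φ b = b' := Subtype.ext hxb
    change monoidHomOfForallMemZpowers hgen hord (φ b) = c
    rw [this, monoidHomOfForallMemZpowers_apply_gen]

/-- The set of conjugates of `b` under a subgroup. -/
def conjOrbit (b : G) (P : Subgroup G) : Set G := (fun g => g * b * g⁻¹) '' (P : Set G)

theorem conjOrbit_mono (b : G) {P L : Subgroup G} (h : P ≤ L) : conjOrbit b P ⊆ conjOrbit b L :=
  Set.image_mono h

theorem ncard_conjOrbit (b : G) (P : Subgroup G) :
    (conjOrbit b P).ncard = (centralizer {b}).relIndex P := by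
  let _ : MulAction P G := MulAction.compHom G ((MulAut.conj (G := G)).comp P.subtype)
  have hsmul : ∀ (g : P) (c : G), g • c = g * c * (g : G)⁻¹ := fun g c => rfl
  have h1 : MulAction.orbit P b = conjOrbit b P := by
    ext c
    constructor
    · rintro ⟨g, rfl⟩
      exact ⟨g, g.2, rfl⟩
    · rintro ⟨g, hg, rfl⟩
      exact ⟨⟨g, hg⟩, rfl⟩
  have h2 : MulAction.stabilizer P b = (centralizer {b}).subgroupOf P := by
    ext g
    rw [MulAction.mem_stabilizer_iff, hsmul, mem_subgroupOf, mem_centralizer_singleton_iff,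
      mul_inv_eq_iff_eq_mul]
  rw [← h1, ← MulAction.index_stabilizer, h2, relIndex]

theorem relIndex_mul_natCard_inf (P L : Subgroup G) :
    L.relIndex P * Nat.card (P ⊓ L : Subgroup G) = Nat.card P := by
  rw [← inf_relIndex_left P L, mul_comm, ← relIndex_bot_left, ← relIndex_bot_left]
  exact relIndex_mul_relIndex _ _ _ bot_le inf_le_left

end

/-- `x` is a retraction of `G` onto the cyclic subgroup `⟨b⟩` of order `q ^ v`, and the order of
its kernel is prime to `q`. -/
structure IsCoprimeRetraction {G : Type*} [Group G] (q v : ℕ) (x : Monoid.End G) (b : G) :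
    Prop where
  apply_mem : ∀ g, x g ∈ zpowers b
  apply_self : x b = b
  orderOf_eq : orderOf b = q ^ v
  not_dvd : ¬ q ∣ Nat.card (endKer x)

namespace IsCoprimeRetraction

variable {G : Type*} [Group G] {q v : ℕ} {x : Monoid.End G} {b : G}

theorem apply_of_mem (h : IsCoprimeRetraction q v x b) {c : G} (hc : c ∈ zpowers b) :
    x c = c := by
  obtain ⟨k, rfl⟩ := mem_zpowers_iff.1 hc
  rw [map_zpow, h.apply_self]

theorem apply_apply (h : IsCoprimeRetraction q v x b) (g : G) : x (x g) = x g :=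
  h.apply_of_mem (h.apply_mem g)

theorem mul_inv_mem (h : IsCoprimeRetraction q v x b) (g : G) : g * (x g)⁻¹ ∈ endKer x := by
  rw [mem_endKer, map_mul, map_inv, h.apply_apply, mul_inv_cancel]

theorem eq_one_of_mem (h : IsCoprimeRetraction q v x b) {c : G} (hc : c ∈ zpowers b)
    (hc' : c ∈ endKer x) : c = 1 := by
  rw [← h.apply_of_mem hc, mem_endKer.1 hc']

theorem apply_mul_comm (h : IsCoprimeRetraction q v x b) (g k : G) : x g * x k = x k * x g := by
  obtain ⟨i, hi⟩ := mem_zpowers_iff.1 (h.apply_mem g)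
  obtain ⟨j, hj⟩ := mem_zpowers_iff.1 (h.apply_mem k)
  rw [← hi, ← hj, ← zpow_add, ← zpow_add, add_comm]

theorem apply_conj (h : IsCoprimeRetraction q v x b) (g c : G) : x (g * c * g⁻¹) = x c := by
  rw [map_mul, map_mul, h.apply_mul_comm g, mul_assoc, ← map_mul, mul_inv_cancel, map_one,
    mul_one]

theorem commutator_le (h : IsCoprimeRetraction q v x b) : commutator G ≤ endKer x := by
  rw [commutator_def, Subgroup.commutator_le]
  intro g _ k _
  rw [mem_endKer, commutatorElement_def, map_mul, map_mul, map_mul, h.apply_mul_comm g, mul_assoc,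
    mul_assoc, ← mul_assoc (x g), ← map_mul, mul_inv_cancel, map_one, one_mul, ← map_mul,
    mul_inv_cancel, map_one]

/-- An endomorphism trivial on the kernel of the retraction factors through the retraction. -/
theorem apply_eq_of_le_ker (h : IsCoprimeRetraction q v x b) {z : Monoid.End G}
    (hz : endKer x ≤ endKer z) (g : G) : z g = z (x g) := by
  have := mem_endKer.1 (hz (h.mul_inv_mem g))
  rw [map_mul, map_inv, mul_inv_eq_one] at this
  exact this

theorem end_ext (h : IsCoprimeRetraction q v x b) {y z : Monoid.End G}
    (hy : endKer x ≤ endKer y) (hz : endKer x ≤ endKer z) (hb : y b = z b) : y = z := by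
  refine Monoid.End.ext _ fun g => ?_
  rw [h.apply_eq_of_le_ker hy, h.apply_eq_of_le_ker hz]
  obtain ⟨k, hk⟩ := mem_zpowers_iff.1 (h.apply_mem g)
  rw [← hk, map_zpow, map_zpow, hb]

theorem exists_end (h : IsCoprimeRetraction q v x b) {c : G} (hc : c ^ q ^ v = 1) :
    ∃ z : Monoid.End G, endKer x ≤ endKer z ∧ z b = c :=
  exists_end_of_orderOf_dvd h.apply_mem h.apply_self
    (h.orderOf_eq ▸ orderOf_dvd_of_pow_eq_one hc)

theorem natCard_eq (h : IsCoprimeRetraction q v x b) :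
    Nat.card G = Nat.card (endKer x) * q ^ v := by
  have h1 : (x : G →* G).range = zpowers b := by
    refine le_antisymm ?_ fun c hc => ⟨c, h.apply_of_mem hc⟩
    rintro _ ⟨g, rfl⟩
    exact h.apply_mem g
  rw [← card_mul_index (endKer x), ← h.orderOf_eq, ← Nat.card_zpowers, ← h1]
  exact congrArg _ (index_ker _)

theorem pow_orderOf (h : IsCoprimeRetraction q v x b) : b ^ q ^ v = 1 := by
  rw [← h.orderOf_eq, pow_orderOf_eq_one]

theorem eq_one_of_pow (h : IsCoprimeRetraction q v x b) (hq : q.Prime) {n : G}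
    (hn : n ∈ endKer x) {m : ℕ} (hm : n ^ q ^ m = 1) : n = 1 := by
  have h1 : orderOf n ∣ Nat.card (endKer x) := orderOf_dvd_natCard _ hn
  obtain ⟨k, -, hk⟩ := (Nat.dvd_prime_pow hq).1 (orderOf_dvd_of_pow_eq_one hm)
  rcases k.eq_zero_or_pos with rfl | hk0
  · simpa using hk
  · exact absurd (((dvd_pow_self q hk0.ne').trans hk.symm.dvd).trans h1) h.not_dvd

/-- `⟨b⟩` is a Sylow `q`-subgroup, because the order of the kernel is prime to `q`. -/
theorem exists_mem_zpowers_conj [Finite G] (h : IsCoprimeRetraction q v x b) (hq : q.Prime)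
    {c : G} {m : ℕ} (hc : c ^ q ^ m = 1) : ∃ g : G, c ∈ zpowers (g * b * g⁻¹) := by
  have : Fact q.Prime := ⟨hq⟩
  have hcard : Nat.card (zpowers b) = q ^ (Nat.card G).factorization q := by
    have hv : (Nat.card G).factorization q = v := by
      rw [h.natCard_eq, Nat.factorization_mul Nat.card_pos.ne' (pow_pos hq.pos v).ne',
        Finsupp.add_apply, Nat.factorization_eq_zero_of_not_dvd h.not_dvd,
        hq.factorization_pow, Finsupp.single_eq_same, zero_add]
    rw [Nat.card_zpowers, h.orderOf_eq, hv]
  let Q : Sylow q G := Sylow.ofCard (zpowers b) hcard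
  have hB : IsPGroup q (zpowers c) := by
    obtain ⟨k, -, hk⟩ := (Nat.dvd_prime_pow hq).1 (orderOf_dvd_of_pow_eq_one hc)
    exact IsPGroup.of_card (n := k) (by rw [Nat.card_zpowers, hk])
  obtain ⟨R, hR⟩ := hB.exists_le_sylow
  obtain ⟨g, rfl⟩ := MulAction.exists_smul_eq G Q R
  refine ⟨g, ?_⟩
  have h1 : c ∈ ((g • Q : Sylow q G) : Subgroup G) := hR (mem_zpowers c)
  rw [Sylow.coe_subgroup_smul, mem_pointwise_smul_iff_inv_smul_mem] at h1
  obtain ⟨k, hk⟩ := mem_zpowers_iff.1 (show (MulAut.conj g)⁻¹ • c ∈ zpowers b from h1)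
  refine mem_zpowers_iff.2 ⟨k, ?_⟩
  rw [conj_zpow, hk]
  change g * ((MulAut.conj g)⁻¹ c) * g⁻¹ = c
  rw [MulAut.conj_inv_apply]
  group

/-- `c` is a power of a conjugate of `b`, and `x`, being constant on conjugacy classes, reads off
that power. -/
theorem exists_eq_conj [Finite G] (h : IsCoprimeRetraction q v x b) (hq : q.Prime)
    {c : G} {m : ℕ} (hc : c ^ q ^ m = 1) (hxc : x c = b) : ∃ g : G, c = g * b * g⁻¹ := by
  obtain ⟨g, hg⟩ := h.exists_mem_zpowers_conj hq hc
  obtain ⟨k, rfl⟩ := mem_zpowers_iff.1 hg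
  refine ⟨g, ?_⟩
  rw [map_zpow, h.apply_conj, h.apply_self] at hxc
  rw [conj_zpow, hxc]

/-- The elements of `[x]` are the retractions with the same kernel onto conjugates of `⟨b⟩`. -/
theorem of_mem_idemClass (h : IsCoprimeRetraction q v x b) {y : Monoid.End G}
    (hy : y ∈ idemClass x) : endKer y = endKer x ∧ x (y b) = b ∧ y (y b) = y b := by
  obtain ⟨h1, h2, h3⟩ := hy
  have h2' : ∀ g, y (x g) = y g := DFunLike.congr_fun h2
  have h3' : ∀ g, x (y g) = x g := DFunLike.congr_fun h3
  refine ⟨le_antisymm (fun g hg => ?_) fun g hg => ?_, ?_, DFunLike.congr_fun h1 b⟩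
  · rw [mem_endKer] at hg ⊢
    rw [← h3', hg, map_one]
  · rw [mem_endKer] at hg ⊢
    rw [← h2', hg, map_one]
  · rw [h3', h.apply_self]

theorem exists_conj_of_mem_idemClass [Finite G] (h : IsCoprimeRetraction q v x b)
    (hq : q.Prime) {y : Monoid.End G} (hy : y ∈ idemClass x) : ∃ g : G, y b = g * b * g⁻¹ := by
  refine h.exists_eq_conj hq (m := v) ?_ (h.of_mem_idemClass hy).2.1
  rw [← map_pow, h.pow_orderOf, map_one]

theorem exists_mem_idemClass (h : IsCoprimeRetraction q v x b) (g : G) :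
    ∃ y ∈ idemClass x, y b = g * b * g⁻¹ := by
  obtain ⟨y, hy, hyb⟩ := h.exists_end (c := g * b * g⁻¹) (by
    rw [conj_pow, h.pow_orderOf, mul_one, mul_inv_cancel])
  have hyx : ∀ k, y (x k) = y k := fun k => (h.apply_eq_of_le_ker hy k).symm
  have hxy : x (y b) = x b := by rw [hyb, h.apply_conj]
  have hker : ∀ z : Monoid.End G, endKer x ≤ endKer (z * y) := fun z n hn => by
    change z (y n) = 1
    rw [mem_endKer.1 (hy hn), map_one]
  refine ⟨y, ⟨h.end_ext (hker y) hy ?_, Monoid.End.ext _ hyx, ?_⟩, hyb⟩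
  · change y (y b) = y b
    rw [← hyx (y b), hxy, h.apply_self]
  · exact h.end_ext (hker x) le_rfl hxy

/-- An element of `[x]` has the same kernel as `x`, so its value at `b` determines it; the possible
values are the conjugates of `b`. -/
theorem ncard_idemClass [Finite G] (h : IsCoprimeRetraction q v x b) (hq : q.Prime) :
    (idemClass x).ncard = (conjOrbit b ⊤).ncard := by
  refine Set.ncard_congr (fun y _ => y b) ?_ ?_ ?_
  · intro y hy
    obtain ⟨g, hg⟩ := h.exists_conj_of_mem_idemClass hq hy
    exact ⟨g, trivial, hg.symm⟩
  · intro y z hy hz hyz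
    exact h.end_ext (h.of_mem_idemClass hy).1.ge (h.of_mem_idemClass hz).1.ge hyz
  · rintro _ ⟨g, -, rfl⟩
    obtain ⟨y, hy, hyb⟩ := h.exists_mem_idemClass g
    exact ⟨y, hy, hyb⟩

/-- The only conjugate of `b` by elements of the kernel that commutes with `b` is `b` itself. -/
theorem eq_of_commute (h : IsCoprimeRetraction q v x b) (hq : q.Prime) {c : G}
    (hc : c ^ q ^ v = 1) (hxc : x c = b) (hbc : b * c = c * b) : c = b := by
  have h1 : c * b⁻¹ ∈ endKer x := by
    rw [mem_endKer, map_mul, map_inv, hxc, h.apply_self, mul_inv_cancel]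
  have h2 : (c * b⁻¹) ^ q ^ v = 1 := by
    have : Commute c b⁻¹ := (show Commute c b from hbc.symm).inv_right
    rw [this.mul_pow, hc, inv_pow, h.pow_orderOf, inv_one, one_mul]
  exact mul_inv_eq_one.1 (h.eq_one_of_pow hq h1 h2)

/-- If `b` normalizes a subgroup `P` of the kernel, then the number of its conjugates under `P`
is `1` modulo `q`. -/
theorem ncard_conjOrbit_modEq [Finite G] (h : IsCoprimeRetraction q v x b) (hq : q.Prime)
    {P : Subgroup G} (hb : ∀ g ∈ P, b * g * b⁻¹ ∈ P) :
    (conjOrbit b P).ncard ≡ 1 [MOD q] := by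
  have : Fact q.Prime := ⟨hq⟩
  have hnorm : ∀ c ∈ zpowers b, ∀ g ∈ P, c * g * c⁻¹ ∈ P := by
    have hb' : b ∈ normalizer (P : Set G) := mem_normalizer_fintype hb
    intro c hc g hg
    exact (mem_normalizer_iff.1 ((zpowers_le.2 hb') hc) g).1 hg
  -- The `q`-group `⟨b⟩` acts on the orbit by conjugation, and by `eq_of_commute` its only fixed
  -- point is `b`.
  let _ : MulAction (zpowers b) (conjOrbit b P) :=
    { smul := fun c d => ⟨c * d * (c : G)⁻¹, by
        obtain ⟨_, g, hg, rfl⟩ := d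
        refine ⟨c * g * (c : G)⁻¹, hnorm c c.2 g hg, ?_⟩
        have : (c : G) * b = b * c := by
          obtain ⟨k, hk⟩ := mem_zpowers_iff.1 c.2
          rw [← hk, ← zpow_add_one, ← zpow_one_add, add_comm]
        have h2 : b = (c : G)⁻¹ * b * c := by rw [mul_assoc, ← this, inv_mul_cancel_left]
        calc _ = c * g * ((c : G)⁻¹ * b * c) * g⁻¹ * (c : G)⁻¹ := by dsimp only; group
          _ = c * (g * b * g⁻¹) * (c : G)⁻¹ := by rw [← h2]; group⟩
      one_smul := fun d => Subtype.ext (by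
        change ((1 : zpowers b) : G) * d * ((1 : zpowers b) : G)⁻¹ = d
        simp)
      mul_smul := fun c c' d => Subtype.ext (by
        change ((c * c' : zpowers b) : G) * d * ((c * c' : zpowers b) : G)⁻¹ =
          c * (c' * d * (c' : G)⁻¹) * (c : G)⁻¹
        rw [coe_mul]
        group) }
  have hsmul : ∀ (c : zpowers b) (d : conjOrbit b P), ((c • d : conjOrbit b P) : G) =
      c * d * (c : G)⁻¹ := fun _ _ => rfl
  have hQ : IsPGroup q (zpowers b) :=
    IsPGroup.of_card (n := v) (by rw [Nat.card_zpowers, h.orderOf_eq])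
  have hmod := hQ.card_modEq_card_fixedPoints (conjOrbit b P)
  rw [Nat.card_coe_set_eq] at hmod
  refine hmod.trans ?_
  have : MulAction.fixedPoints (zpowers b) (conjOrbit b P) =
      {⟨b, 1, P.one_mem, by simp⟩} := by
    ext d
    rw [MulAction.mem_fixedPoints, Set.mem_singleton_iff]
    constructor
    · intro hd
      have h1 := congrArg Subtype.val (hd ⟨b, mem_zpowers b⟩)
      rw [hsmul, mul_inv_eq_iff_eq_mul] at h1
      obtain ⟨_, g, hg, rfl⟩ := d
      refine Subtype.ext (h.eq_of_commute hq ?_ ?_ h1)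
      · dsimp only
        rw [conj_pow, h.pow_orderOf, mul_one, mul_inv_cancel]
      · exact (h.apply_conj g b).trans h.apply_self
    · rintro rfl c
      refine Subtype.ext ?_
      rw [hsmul]
      obtain ⟨k, hk⟩ := mem_zpowers_iff.1 c.2
      rw [← hk, mul_inv_eq_iff_eq_mul, ← zpow_add_one, ← zpow_one_add, add_comm]
  rw [this, Nat.card_coe_set_eq, Set.ncard_singleton]

/-- An element of the kernel whose commutator with `b` commutes with `b` commutes with `b`. -/
theorem commute_of_commutator_commute (h : IsCoprimeRetraction q v x b) (hq : q.Prime) {g : G}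
    (hg : b * (g⁻¹ * b * g) = g⁻¹ * b * g * b) : b * g = g * b := by
  have h1 := h.eq_of_commute hq (c := g⁻¹ * b * g) ?_ ?_ hg
  · rw [mul_assoc, inv_mul_eq_iff_eq_mul] at h1
    exact h1
  · have := conj_pow (i := q ^ v) (a := g⁻¹) (b := b)
    rw [inv_inv, h.pow_orderOf, mul_one, inv_mul_cancel] at this
    exact this
  · have := h.apply_conj g⁻¹ b
    rwa [inv_inv, h.apply_self] at this

end IsCoprimeRetraction

/-- The semigroup `K(x)` of an idempotent is the endomorphism semigroup of its image. -/
theorem nonempty_K_mulEquiv {G : Type*} [Group G] {x : Monoid.End G} {L : Subgroup G}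
    (hL : ∀ g, x g ∈ L) (hx : ∀ g ∈ L, x g = g) : Nonempty (K x ≃* Monoid.End L) := by
  let φ : G →* L := (x : G →* G).codRestrict L hL
  have hφ : ∀ g : L, φ g = g := fun g => Subtype.ext (hx g g.2)
  have hφ' : ∀ g, (φ g : G) = x g := fun g => rfl
  have h1 : ∀ y : K x, ∀ g, x (y.1 g) = y.1 g := fun y => DFunLike.congr_fun y.2.1
  have h2 : ∀ y : K x, ∀ g, y.1 (x g) = y.1 g := fun y => DFunLike.congr_fun y.2.2
  let F : K x → Monoid.End L := fun y => φ.comp ((y.1 : G →* G).comp L.subtype)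
  have hF : ∀ y g, (F y g : G) = y.1 g := fun y g => h1 y g
  let E : Monoid.End L → K x := fun f => ⟨L.subtype.comp ((f : L →* L).comp φ),
    Monoid.End.ext _ fun g => hx _ (f (φ g)).2,
    Monoid.End.ext _ fun g => by
      change ((f (φ (x g)) : L) : G) = f (φ g)
      rw [← hφ', hφ]⟩
  refine ⟨{ toFun := F, invFun := E, left_inv := ?_, right_inv := ?_, map_mul' := ?_ }⟩
  · intro y
    refine Subtype.ext (Monoid.End.ext _ fun g => ?_)
    exact (hF y (φ g)).trans (h2 y g)
  · intro f
    refine Monoid.End.ext _ fun g => Subtype.ext ?_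
    refine (hF (E f) g).trans ?_
    change ((f (φ g) : L) : G) = f g
    rw [hφ]
  · intro y z
    refine Monoid.End.ext _ fun g => Subtype.ext ?_
    refine (hF (y * z) g).trans ?_
    change y.1 (z.1 g) = F y (F z g)
    rw [hF, hF]

end SchmidtEnd

/-! ### Irreducible `𝔽_p`-modules for a cyclic group of order `q` -/

theorem Nat.Prime.pow_orderOf_modEq {p q : ℕ} (hq : q.Prime) :
    p ^ orderOf (p : ZMod q) ≡ 1 [MOD q] := by
  have : Fact q.Prime := ⟨hq⟩
  rw [← ZMod.natCast_eq_natCast_iff, Nat.cast_pow, pow_orderOf_eq_one, Nat.cast_one]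

theorem Nat.Prime.orderOf_natCast_pos {p q : ℕ} (hp : p.Prime) (hq : q.Prime) (hpq : p ≠ q) :
    0 < orderOf (p : ZMod q) := by
  have : Fact q.Prime := ⟨hq⟩
  refine orderOf_pos_iff.2 (isOfFinOrder_iff_pow_eq_one.2 ⟨q - 1, Nat.sub_pos_of_lt hq.one_lt,
    ZMod.pow_card_sub_one_eq_one fun h => ?_⟩)
  exact hpq ((Nat.prime_dvd_prime_iff_eq hq hp).1 ((ZMod.natCast_eq_zero_iff _ _).1 h)).symm

theorem AddMonoid.End.charP {W : Type*} [AddCommGroup W] [Nontrivial W] {p : ℕ} (hp : p.Prime)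
    (hpW : ∀ w : W, p • w = 0) : CharP (AddMonoid.End W) p := by
  obtain ⟨w, hw⟩ := exists_ne (0 : W)
  have : Nontrivial (AddMonoid.End W) := ⟨1, 0, fun h => hw (DFunLike.congr_fun h w)⟩
  refine (CharP.charP_iff_prime_eq_zero hp).2 ?_
  refine DFunLike.ext _ _ fun w => ?_
  rw [AddMonoid.End.natCast_apply, hpW]
  rfl

/-- An endomorphism of an elementary abelian `p`-group whose `p`-th power is the identity has a
nontrivial fixed point. -/
theorem subsingleton_of_pow_eq_one {W : Type*} [AddCommGroup W] {p : ℕ} (hp : p.Prime)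
    (hpW : ∀ w : W, p • w = 0) {T : AddMonoid.End W} (hT : T ^ p = 1)
    (hfix : ∀ w, T w = w → w = 0) : Subsingleton W := by
  by_contra hW
  have : Nontrivial W := not_subsingleton_iff_nontrivial.1 hW
  have : Fact p.Prime := ⟨hp⟩
  have := AddMonoid.End.charP hp hpW
  -- In characteristic `p`, `(T - 1) ^ p = T ^ p - 1`. So `T - 1` is nilpotent, and it cannot be
  -- injective on a nonzero group.
  have h1 : (T - 1) ^ p = 0 := by
    rw [sub_pow_char_of_commute _ (Commute.one_right T), hT, one_pow, sub_self]
  have h2 : ∀ n : ℕ, ∀ w, ((T - 1) ^ n) w = 0 → w = 0 := by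
    intro n
    induction n with
    | zero => exact fun w hw => hw
    | succ n ih =>
      intro w hw
      rw [pow_succ] at hw
      exact hfix w (sub_eq_zero.1 (ih ((T - 1) w) hw))
  obtain ⟨w, hw⟩ := exists_ne (0 : W)
  exact hw (h2 p w (by rw [h1]; rfl))

theorem natCard_le_of_forall_pow_eq {A : Type*} [CommRing A] [IsDomain A] [Finite A] {n : ℕ}
    (hn : 1 < n) (h : ∀ a : A, a ^ n = a) : Nat.card A ≤ n := by
  classical
  have := Fintype.ofFinite A
  let f : Polynomial A := Polynomial.X ^ n - Polynomial.X
  have hf0 : f ≠ 0 := fun h => by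
    have := congrArg (Polynomial.coeff · n) h
    simp [f, Polynomial.coeff_X, hn.ne] at this
  have hdeg : f.natDegree ≤ n := by
    refine (Polynomial.natDegree_sub_le _ _).trans (max_le (Polynomial.natDegree_X_pow_le _) ?_)
    exact Polynomial.natDegree_X_le.trans hn.le
  rw [Nat.card_eq_fintype_card]
  refine (Polynomial.card_le_degree_of_subset_roots (p := f) (Z := Finset.univ) ?_).trans hdeg
  intro a _
  rw [Polynomial.mem_roots hf0, Polynomial.IsRoot.def, Polynomial.eval_sub, Polynomial.eval_pow,
    Polynomial.eval_X, h, sub_self]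

/-- An irreducible module over `𝔽_p` for a cyclic group of prime order `q` has at most `p ^ u`
elements, where `u` is the order of `p` modulo `q`. -/
theorem natCard_le_of_irreducible {W : Type*} [AddCommGroup W] [Finite W] {p q : ℕ}
    (hp : p.Prime) (hq : q.Prime) (hpq : p ≠ q) (hpW : ∀ w : W, p • w = 0) {T : AddMonoid.End W}
    (hT : T ^ q = 1)
    (hirr : ∀ U : AddSubgroup W, (∀ w ∈ U, T w ∈ U) → U = ⊥ ∨ U = ⊤) :
    Nat.card W ≤ p ^ orderOf (p : ZMod q) := by
  classical
  rcases subsingleton_or_nontrivial W with hW | hW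
  · rw [Nat.card_of_subsingleton (0 : W)]
    exact Nat.one_le_pow _ _ hp.pos
  obtain ⟨w₀, hw₀⟩ := exists_ne (0 : W)
  have : Fact p.Prime := ⟨hp⟩
  have := AddMonoid.End.charP hp hpW
  set u := orderOf (p : ZMod q)
  have hTu : T ^ p ^ u = T := by
    rw [pow_eq_pow_mod _ hT, (hq.pow_orderOf_modEq : p ^ u % q = 1 % q),
      Nat.mod_eq_of_lt hq.one_lt, pow_one]
  -- `A` is `𝔽_p[T]`. The `p ^ u`-power map is additive on it and fixes `T`, so it is the identity;
  -- Schur's lemma makes `A` a domain, so `A` has at most `p ^ u` elements.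
  let A := Subring.closure {T}
  have : IsMulCommutative A := Subring.isMulCommutative_closure (by
    rintro _ rfl _ rfl
    rfl)
  have hcomm : ∀ a ∈ A, ∀ c ∈ A, a * c = c * a := fun a ha c hc =>
    congrArg Subtype.val (this.is_comm.comm (⟨a, ha⟩ : A) ⟨c, hc⟩)
  have hTA : T ∈ A := Subring.subset_closure rfl
  have hfrob : ∀ a ∈ A, a ^ p ^ u = a := by
    intro a ha
    induction ha using Subring.closure_induction with
    | mem a ha =>
      obtain rfl : a = T := ha
      exact hTu
    | zero => exact zero_pow (pow_pos hp.pos u).ne'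
    | one => exact one_pow _
    | add a c ha hc iha ihc =>
      rw [add_pow_char_pow_of_commute (p := p) (h := hcomm a ha c hc), iha, ihc]
    | neg a ha iha =>
      have h0 := add_pow_char_pow_of_commute (p := p) (n := u)
        (h := (Commute.refl a).neg_right)
      rw [add_neg_cancel, zero_pow (pow_pos hp.pos u).ne', iha] at h0
      exact (neg_eq_of_add_eq_zero_right h0.symm).symm
    | mul a c ha hc iha ihc =>
      rw [(show Commute a c from hcomm a ha c hc).mul_pow, iha, ihc]
  have hinj : ∀ a ∈ A, a ≠ 0 → ∀ w, a w = 0 → w = 0 := by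
    intro a ha ha0 w hw
    have h1 : ∀ w, a (T w) = T (a w) := fun w => DFunLike.congr_fun (hcomm a ha T hTA) w
    let U : AddSubgroup W := AddMonoidHom.ker (a : W →+ W)
    have hU : ∀ w, w ∈ U ↔ a w = 0 := fun w => Iff.rfl
    rcases hirr U (fun w hw => by rw [hU, h1, (hU w).1 hw, map_zero]) with h | h
    · exact AddSubgroup.mem_bot.1 (h ▸ (hU w).2 hw)
    · exact absurd (DFunLike.ext _ _ fun w => (hU w).1 (h ▸ AddSubgroup.mem_top w)) ha0
  have hnt : Nontrivial A := ⟨1, 0, fun h => hw₀ (DFunLike.congr_fun (congrArg Subtype.val h) w₀)⟩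
  have hdom : IsDomain A := by
    have : NoZeroDivisors A := ⟨fun {a c} hac => by
      by_contra hne
      push Not at hne
      have ha : (a : AddMonoid.End W) ≠ 0 := fun h => hne.1 (Subtype.ext h)
      have hc : (c : AddMonoid.End W) ≠ 0 := fun h => hne.2 (Subtype.ext h)
      exact hw₀ (hinj c c.2 hc _ (hinj a a.2 ha _
        (DFunLike.congr_fun (congrArg Subtype.val hac) w₀)))⟩
    exact NoZeroDivisors.to_isDomain A
  have : Finite (AddMonoid.End W) := Finite.of_injective (fun f : AddMonoid.End W => (f : W → W))
    DFunLike.coe_injective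
  have hcard : Nat.card A ≤ p ^ u := by
    let _ : CommRing A := { (inferInstance : Ring A) with
      mul_comm := fun a c => Subtype.ext (hcomm a a.2 c c.2) }
    exact natCard_le_of_forall_pow_eq (Nat.one_lt_pow (hp.orderOf_natCast_pos hq hpq).ne' hp.one_lt)
      fun a => Subtype.ext (hfrob a a.2)
  -- `A w₀` is a nonzero submodule, hence all of `W`.
  have hsurj : Function.Surjective (fun a : A => (a : AddMonoid.End W) w₀) := by
    let φ : A →+ W := { toFun := fun a => (a : AddMonoid.End W) w₀, map_zero' := rfl,
                        map_add' := fun _ _ => rfl }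
    rcases hirr φ.range (by
      rintro _ ⟨a, rfl⟩
      exact ⟨⟨T, hTA⟩ * a, rfl⟩) with h | h
    · exact absurd (AddSubgroup.mem_bot.1 (h ▸ (⟨1, rfl⟩ : w₀ ∈ φ.range))) hw₀
    · intro w
      have : w ∈ φ.range := h ▸ AddSubgroup.mem_top w
      exact this
  exact (Nat.card_le_card_of_surjective _ hsurj).trans hcard

theorem Nat.Prime.orderOf_dvd_of_pow_modEq {p q n : ℕ} (h : p ^ n ≡ 1 [MOD q]) :
    orderOf (p : ZMod q) ∣ n := by
  refine orderOf_dvd_of_pow_eq_one ?_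
  rw [← ZMod.natCast_eq_natCast_iff, Nat.cast_pow, Nat.cast_one] at h
  exact h

/-! ### Structure of the derived subgroup of a Schmidt group -/

namespace SchmidtEnd

namespace IsCoprimeRetraction

variable {G : Type u} [Group G] {q v : ℕ} {x : Monoid.End G} {b : G}

/-- Since `x g` commutes with `b`, the elements `g` and `g * (x g)⁻¹` conjugate `b` in the same way.
-/
theorem conjOrbit_top (h : IsCoprimeRetraction q v x b) :
    conjOrbit b ⊤ = conjOrbit b (endKer x) := by
  refine subset_antisymm ?_ (conjOrbit_mono b le_top)
  rintro _ ⟨g, -, rfl⟩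
  refine ⟨g * (x g)⁻¹, h.mul_inv_mem g, ?_⟩
  obtain ⟨k, hk⟩ := mem_zpowers_iff.1 (h.apply_mem g)
  have : b * x g = x g * b := by rw [← hk, ← zpow_add_one, ← zpow_one_add, add_comm]
  dsimp only
  calc g * (x g)⁻¹ * b * (g * (x g)⁻¹)⁻¹ = g * (x g)⁻¹ * (b * x g) * g⁻¹ := by group
    _ = g * b * g⁻¹ := by rw [this]; group

theorem mem_center (h : IsCoprimeRetraction q v x b) {c : G}
    (hN : ∀ g ∈ endKer x, g * c = c * g) (hb : b * c = c * b) : c ∈ center G := by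
  rw [mem_center_iff]
  intro g
  obtain ⟨k, hk⟩ := mem_zpowers_iff.1 (h.apply_mem g)
  have h1 : Commute (x g) c := by
    rw [← hk]
    exact (show Commute b c from hb).zpow_left k
  have h2 : Commute (g * (x g)⁻¹) c := hN _ (h.mul_inv_mem g)
  have := h2.mul_left h1
  rwa [inv_mul_cancel_right] at this

/-- The subgroup `P⟨b⟩` of `G`, when `b` normalizes a subgroup `P` of the kernel. -/
theorem exists_extension [Finite G] (h : IsCoprimeRetraction q v x b) {P : Subgroup G}
    (hP : P ≤ endKer x) (hb : ∀ g ∈ P, b * g * b⁻¹ ∈ P) :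
    ∃ L : Subgroup G, P ≤ L ∧ b ∈ L ∧ ∀ g ∈ L, g ∈ endKer x → g ∈ P := by
  have hnorm : ∀ c ∈ zpowers b, ∀ g ∈ P, c * g * c⁻¹ ∈ P := by
    have hb' : b ∈ normalizer (P : Set G) := mem_normalizer_fintype hb
    intro c hc g hg
    exact (mem_normalizer_iff.1 ((zpowers_le.2 hb') hc) g).1 hg
  -- An element is in `P⟨b⟩` exactly when its component in the kernel is in `P`.
  refine ⟨{ carrier := {g | g * (x g)⁻¹ ∈ P}, mul_mem' := ?_, one_mem' := ?_, inv_mem' := ?_ },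
    ?_, ?_, ?_⟩
  · intro g k hg hk
    have := P.mul_mem hg (hnorm _ (h.apply_mem g) _ hk)
    change g * k * (x (g * k))⁻¹ ∈ P
    convert this using 1
    rw [map_mul]
    group
  · change 1 * (x 1)⁻¹ ∈ P
    rw [map_one, inv_one, mul_one]
    exact P.one_mem
  · intro g hg
    have := hnorm _ (inv_mem (h.apply_mem g)) _ (P.inv_mem hg)
    change g⁻¹ * (x g⁻¹)⁻¹ ∈ P
    convert this using 1
    rw [map_inv]
    group
  · intro g hg
    change g * (x g)⁻¹ ∈ P
    rwa [mem_endKer.1 (hP hg), inv_one, mul_one]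
  · change b * (x b)⁻¹ ∈ P
    rw [h.apply_self, mul_inv_cancel]
    exact P.one_mem
  · intro g hg hgN
    change g * (x g)⁻¹ ∈ P at hg
    rwa [mem_endKer.1 hgN, inv_one, mul_one] at hg

end IsCoprimeRetraction

/-- A retraction of a Schmidt group with parameters `p, q, v` whose kernel is the derived
subgroup. -/
structure IsSchmidtRetraction {G : Type*} [Group G] (p q v : ℕ) (x : Monoid.End G) (b : G) : Prop
    extends IsCoprimeRetraction q v x b where
  prime_left : p.Prime
  prime_right : q.Prime
  ne : p ≠ q
  one_le : 1 ≤ v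
  isPGroup : IsPGroup p (endKer x)
  commutator_eq : commutator G = endKer x
  isNilpotent : ∀ L : Subgroup G, L ≠ ⊤ → Group.IsNilpotent L
  not_isNilpotent : ¬ Group.IsNilpotent G

namespace IsSchmidtRetraction

variable {G : Type u} [Group G] {p q v : ℕ} {x : Monoid.End G} {b : G}

theorem exists_pow (h : IsSchmidtRetraction p q v x b) {g : G} (hg : g ∈ endKer x) :
    ∃ k : ℕ, g ^ p ^ k = 1 := by
  obtain ⟨k, hk⟩ := h.isPGroup ⟨g, hg⟩
  exact ⟨k, congrArg Subtype.val hk⟩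

variable [Finite G]

/-- Otherwise `b` is central, and every element has a central `p`-power, so `G` is nilpotent. -/
theorem not_forall_commute (h : IsSchmidtRetraction p q v x b) :
    ¬ ∀ g ∈ endKer x, g * b = b * g := by
  intro hc
  have hb : b ∈ center G := h.mem_center hc rfl
  refine h.not_isNilpotent (Group.isNilpotent_of_pow_mem_center h.prime_left fun g => ?_)
  obtain ⟨k, hk⟩ := h.exists_pow (h.mul_inv_mem g)
  have hxg : x g ∈ center G := (zpowers_le.2 hb) (h.apply_mem g)
  have h1 : Commute (g * (x g)⁻¹) (x g) := (mem_center_iff.1 hxg _)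
  have h2 := h1.mul_pow (p ^ k)
  rw [hk, one_mul, inv_mul_cancel_right] at h2
  exact ⟨k, h2 ▸ pow_mem hxg _⟩

/-- A proper subgroup of the kernel normalized by `b` is centralized by `b`. -/
theorem commute_of_ne (h : IsSchmidtRetraction p q v x b) {P : Subgroup G}
    (hP : P ≤ endKer x) (hb : ∀ g ∈ P, b * g * b⁻¹ ∈ P) (hne : P ≠ endKer x) {g : G}
    (hg : g ∈ P) : g * b = b * g := by
  -- `L = P⟨b⟩` is proper, hence nilpotent, so its `p`-elements commute with `b`.
  obtain ⟨L, hPL, hbL, hL⟩ := h.exists_extension hP hb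
  have hLtop : L ≠ ⊤ := by
    rintro rfl
    exact hne (le_antisymm hP fun g hg => hL g (mem_top g) hg)
  obtain ⟨k, hk⟩ := h.exists_pow (hP hg)
  exact congrArg Subtype.val ((h.isNilpotent L hLtop).commute_of_pow_eq_one h.prime_left
    h.prime_right h.ne (a := ⟨g, hPL hg⟩) (b := ⟨b, hbL⟩) (m := k) (n := v)
    (Subtype.ext hk) (Subtype.ext h.pow_orderOf))

/-- The preimage of `⟨b ^ q⟩` under `x` is a proper subgroup containing the kernel and `b ^ q`;
being nilpotent, it makes them commute. -/
theorem pow_mem_center (h : IsSchmidtRetraction p q v x b) : b ^ q ∈ center G := by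
  refine h.mem_center (fun g hg => ?_) ((Commute.refl b).pow_right q)
  let L : Subgroup G := (zpowers (b ^ q)).comap (x : G →* G)
  have hL : ∀ g, g ∈ L ↔ x g ∈ zpowers (b ^ q) := fun g => Iff.rfl
  have hLtop : L ≠ ⊤ := by
    intro hL'
    have hb : b ∈ L := hL' ▸ mem_top b
    rw [hL, h.apply_self] at hb
    have h1 := Nat.le_of_dvd (orderOf_pos (b ^ q)) (orderOf_dvd_of_mem_zpowers hb)
    rw [orderOf_pow, h.orderOf_eq, Nat.gcd_eq_right (dvd_pow_self q
      (Nat.one_le_iff_ne_zero.1 h.one_le))] at h1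
    exact absurd (Nat.div_lt_self (pow_pos h.prime_right.pos v) h.prime_right.one_lt) h1.not_gt
  obtain ⟨k, hk⟩ := h.exists_pow hg
  have hgL : g ∈ L := by
    rw [hL, mem_endKer.1 hg]
    exact one_mem _
  have hbL : b ^ q ∈ L := by
    rw [hL, map_pow, h.apply_self]
    exact mem_zpowers _
  exact congrArg Subtype.val ((h.isNilpotent L hLtop).commute_of_pow_eq_one h.prime_left
    h.prime_right h.ne (a := ⟨g, hgL⟩) (b := ⟨b ^ q, hbL⟩) (m := k) (n := v)
    (Subtype.ext hk) (Subtype.ext (by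
      change (b ^ q) ^ q ^ v = 1
      rw [← pow_mul, mul_comm, pow_mul, h.pow_orderOf, one_pow])))

/-- The centralizer of `b` in the kernel is central. -/
theorem mem_center_of_commute (h : IsSchmidtRetraction p q v x b) {c : G}
    (hc : c ∈ endKer x) (hcb : c * b = b * c) : c ∈ center G := by
  let C : Subgroup G := endKer x ⊓ centralizer {b}
  have hC : ∀ g, g ∈ C ↔ g ∈ endKer x ∧ g * b = b * g := fun g => by
    rw [mem_inf, mem_centralizer_singleton_iff]
  have hCle : C ≤ endKer x := inf_le_left
  -- `C` is normalized by the kernel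
  have hnorm : ∀ g ∈ endKer x, ∀ c ∈ C, g * c * g⁻¹ ∈ C := by
    by_contra hcon
    -- If `P` were proper in the kernel, `b` would centralize it, so `P ≤ C`. This contradicts the
    -- normalizer condition in a `p`-group.
    let P : Subgroup G := endKer x ⊓ normalizer (C : Set G)
    have hPne : P ≠ endKer x := by
      intro hP
      exact hcon fun g hg c hc => (mem_normalizer_iff.1 (hP.ge hg).2 c).1 hc
    have hbC : b ∈ normalizer (C : Set G) := by
      refine mem_normalizer_fintype fun c hc => ?_
      have : b * c * b⁻¹ = c := by rw [← ((hC c).1 hc).2, mul_inv_cancel_right]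
      rwa [this]
    have hPC : P ≤ C := fun g hg => (hC g).2 ⟨hg.1, h.commute_of_ne inf_le_left
      (fun g hg => ⟨Normal.conj_mem inferInstance g hg.1 b,
        Subgroup.mul_mem _ (Subgroup.mul_mem _ hbC hg.2) (Subgroup.inv_mem _ hbC)⟩) hPne hg⟩
    have : Fact p.Prime := ⟨h.prime_left⟩
    have hnil : Group.IsNilpotent (endKer x) := h.isPGroup.isNilpotent
    have hlt : C.subgroupOf (endKer x) < ⊤ := by
      refine lt_top_iff_ne_top.2 fun htop => h.not_forall_commute fun g hg => ?_
      rw [subgroupOf_eq_top] at htop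
      exact ((hC g).1 (htop hg)).2
    obtain ⟨g, hg, hgC⟩ := SetLike.exists_of_lt
      (Group.normalizerCondition_of_isNilpotent _ hlt)
    refine hgC (mem_subgroupOf.2 (hPC ⟨g.2, mem_normalizer_fintype fun c hc => ?_⟩))
    exact mem_subgroupOf.1 ((mem_normalizer_iff.1 hg ⟨c, hCle hc⟩).1 (mem_subgroupOf.2 hc))
  refine h.mem_center (fun g hg => ?_) hcb.symm
  by_contra hcon
  -- If `P` is proper, `b` centralizes it. As `g * c * g⁻¹ ∈ C` commutes with `b`, the commutator
  -- `g⁻¹ * b * g * b⁻¹` centralizes `c`, so it lies in `P` and commutes with `b`. Then `g` itself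
  -- commutes with `b`, for every `g` in the kernel.
  let P : Subgroup G := endKer x ⊓ centralizer {c}
  have hP : ∀ g, g ∈ P ↔ g ∈ endKer x ∧ g * c = c * g := fun g => by
    rw [mem_inf, mem_centralizer_singleton_iff]
  have hPne : P ≠ endKer x := fun hP' => hcon ((hP g).1 (hP'.ge hg)).2
  have hPb : ∀ g ∈ P, g * b = b * g := fun g hg => h.commute_of_ne inf_le_left
    (fun g hg => by
      have hb : b ∈ centralizer {c} := mem_centralizer_singleton_iff.2 hcb.symm
      exact ⟨Normal.conj_mem inferInstance g hg.1 b,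
        Subgroup.mul_mem _ (Subgroup.mul_mem _ hb hg.2) (Subgroup.inv_mem _ hb)⟩) hPne hg
  refine h.not_forall_commute fun g hg => (h.commute_of_commutator_commute h.prime_right ?_).symm
  have h1 := ((hC _).1 (hnorm g hg c ((hC c).2 ⟨hc, hcb⟩))).2
  have h2 : g⁻¹ * b * g * b⁻¹ ∈ P := by
    refine (hP _).2 ⟨?_, ?_⟩
    · rw [mul_assoc, mul_assoc, ← mul_assoc b]
      exact mul_mem (inv_mem hg) (Normal.conj_mem inferInstance g hg b)
    · have h3 : (g⁻¹ * b * g) * c = c * (g⁻¹ * b * g) := by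
        calc _ = g⁻¹ * (b * (g * c * g⁻¹)) * g := by group
          _ = g⁻¹ * ((g * c * g⁻¹) * b) * g := by rw [h1]
          _ = _ := by group
      exact (show Commute (g⁻¹ * b * g) c from h3).mul_left
        (show Commute b c from hcb.symm).inv_left
  have h3 := (show Commute _ b from hPb _ h2).mul_left (Commute.refl b)
  rw [inv_mul_cancel_right] at h3
  exact h3.symm

/-- The derived subgroup of the nontrivial `p`-group `endKer x` is proper and normalized by `b`; so
`b` centralizes it, and it is central. -/
theorem commutator_commute (h : IsSchmidtRetraction p q v x b) {g k : G}
    (hg : g ∈ endKer x) (hk : k ∈ endKer x) : g * k * g⁻¹ * k⁻¹ ∈ center G := by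
  have hle : ⁅endKer x, endKer x⁆ ≤ endKer x := commutator_le_left _ _
  have hmem : g * k * g⁻¹ * k⁻¹ ∈ ⁅endKer x, endKer x⁆ := commutator_mem_commutator hg hk
  refine h.mem_center_of_commute (hle hmem) (h.commute_of_ne hle ?_ ?_ hmem)
  · exact fun c hc => Normal.conj_mem inferInstance c hc b
  · intro heq
    have : Fact p.Prime := ⟨h.prime_left⟩
    have hnil : Group.IsNilpotent (endKer x) := h.isPGroup.isNilpotent
    have hnt : Nontrivial (endKer x) := by
      rw [nontrivial_iff_ne_bot]
      intro hbot
      refine h.not_forall_commute fun g hg => ?_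
      rw [hbot, mem_bot] at hg
      rw [hg, one_mul, mul_one]
    refine (Group.IsSolvable.commutator_lt_top_of_nontrivial (endKer x)).ne ?_
    apply map_injective (subtype_injective (endKer x))
    rw [map_subtype_commutator, heq, ← MonoidHom.range_eq_map, range_subtype]

/-- Modulo the center the kernel is abelian, so its elements with central `p`-th power form a
subgroup `P` normalized by `b`. If `P` is proper it is central; then induction on the order of the
element makes the whole kernel central. -/
theorem pow_mem_center_of_mem (h : IsSchmidtRetraction p q v x b) {g : G}
    (hg : g ∈ endKer x) : g ^ p ∈ center G := by
  let φ := QuotientGroup.mk' (center G)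
  have hφ : ∀ g, φ g = 1 ↔ g ∈ center G := fun g => QuotientGroup.eq_one_iff g
  have hcomm : ∀ g ∈ endKer x, ∀ k ∈ endKer x, Commute (φ g) (φ k) := by
    intro g hg k hk
    have := (hφ _).2 (h.commutator_commute hg hk)
    rw [map_mul, map_mul, map_mul, map_inv, map_inv, mul_inv_eq_one, mul_inv_eq_iff_eq_mul] at this
    exact this
  let P : Subgroup G :=
    { carrier := {g | g ∈ endKer x ∧ φ g ^ p = 1}
      mul_mem' := fun {g k} hg hk => ⟨mul_mem hg.1 hk.1, by
        rw [map_mul, (hcomm g hg.1 k hk.1).mul_pow, hg.2, hk.2, one_mul]⟩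
      one_mem' := ⟨one_mem _, by rw [map_one, one_pow]⟩
      inv_mem' := fun {g} hg => ⟨inv_mem hg.1, by rw [map_inv, inv_pow, hg.2, inv_one]⟩ }
  have hP : ∀ g, g ∈ P ↔ g ∈ endKer x ∧ g ^ p ∈ center G := fun g => by
    rw [← hφ, map_pow]
    rfl
  by_contra hcon
  have hPne : P ≠ endKer x := fun hP' => hcon ((hP g).1 (hP'.ge hg)).2
  have hPb : ∀ g ∈ P, g ∈ center G := fun g hg => h.mem_center_of_commute ((hP g).1 hg).1
    (h.commute_of_ne (fun g hg => ((hP g).1 hg).1) (fun g hg => (hP _).2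
      ⟨Normal.conj_mem inferInstance g ((hP g).1 hg).1 b, by
        rw [conj_pow]
        exact Normal.conj_mem inferInstance _ ((hP g).1 hg).2 b⟩) hPne hg)
  have key : ∀ k : ℕ, ∀ g ∈ endKer x, g ^ p ^ k = 1 → g ∈ center G := by
    intro k
    induction k with
    | zero =>
      intro g _ hg
      rw [pow_zero, pow_one] at hg
      exact hg ▸ one_mem _
    | succ k ih =>
      intro g hg hgk
      exact hPb g ((hP g).2 ⟨hg, ih _ (pow_mem hg p) (by rw [← pow_mul, ← pow_succ', hgk])⟩)
  obtain ⟨k, hk⟩ := h.exists_pow hg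
  exact hcon (pow_mem (key k g hg hk) p)

end IsSchmidtRetraction
end SchmidtEnd

/-! ### The irreducible module, and the groups `V` and `D` of a Schmidt group -/

theorem AddMonoidHom.exists_end_of_surjective {A W : Type*} [AddGroup A] [AddCommGroup W]
    (π : A →+ W) (hπ : Function.Surjective π) (f : A →+ A) (hf : ∀ a, π a = 0 → π (f a) = 0) :
    ∃ T : AddMonoid.End W, ∀ a, T (π a) = π (f a) := by
  choose s hs using hπ
  have key : ∀ a c, π a = π c → π (f a) = π (f c) := fun a c hac => by
    have := hf (a - c) (by rw [map_sub, hac, sub_self])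
    rwa [map_sub, map_sub, sub_eq_zero] at this
  refine ⟨{ toFun := fun w => π (f (s w)), map_zero' := hf _ (hs 0), map_add' := fun w t => ?_ },
    fun a => key _ _ (hs _)⟩
  rw [← map_add, ← map_add]
  exact key _ _ (by rw [hs, map_add, hs, hs])

namespace SchmidtEnd

theorem apply_mulAut_of_mem_V {G : Type*} [Group G] {x : Monoid.End G} {y : MulAut G}
    (hy : y ∈ V x) (g : G) :
    x (y g) = x g :=
  DFunLike.congr_fun (show x * autToEnd y = x from hy) g

namespace IsCoprimeRetraction

variable {G : Type u} [Group G] {q v : ℕ} {x : Monoid.End G} {b : G}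

/-- This exhibits `D x` as the stabilizer of `b` in `V x`. -/
theorem mem_D_iff (h : IsCoprimeRetraction q v x b) {y : MulAut G} :
    y ∈ D x ↔ y ∈ V x ∧ y b = b := by
  refine and_congr_right fun _ => ⟨fun hy => ?_, fun hy => Monoid.End.ext _ fun g => ?_⟩
  · have := DFunLike.congr_fun hy b
    change y (x b) = x b at this
    rwa [h.apply_self] at this
  · change y (x g) = x g
    obtain ⟨k, hk⟩ := mem_zpowers_iff.1 (h.apply_mem g)
    rw [← hk, map_zpow, hy]

theorem conj_mem_V (h : IsCoprimeRetraction q v x b) (g : G) : MulAut.conj g ∈ V x :=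
  Monoid.End.ext _ fun c => h.apply_conj g c

end IsCoprimeRetraction

namespace IsSchmidtRetraction

variable {G : Type u} [Group G] [Finite G] {p q v : ℕ} {x : Monoid.End G} {b : G}

theorem mem_center_iff_commute (h : IsSchmidtRetraction p q v x b) {c : G}
    (hc : c ∈ endKer x) : c ∈ center G ↔ c * b = b * c :=
  ⟨fun hcc => (mem_center_iff.1 hcc b).symm, h.mem_center_of_commute hc⟩

/-- The quotient of the kernel by the centralizer of `b` is an irreducible module for `⟨b⟩` over
the field with `p` elements. -/
theorem exists_module (h : IsSchmidtRetraction p q v x b) :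
    ∃ (W : Type u) (_ : AddCommGroup W) (_ : Finite W) (π : Additive (endKer x) →+ W)
      (T : AddMonoid.End W), Function.Surjective π ∧
      (∀ g : endKer x, π (Additive.ofMul g) = 0 ↔ (g : G) ∈ center G) ∧
      (∀ w : W, p • w = 0) ∧ Nat.card W = (conjOrbit b (endKer x)).ncard ∧
      (∀ g k : endKer x, (k : G) = b * g * b⁻¹ →
        T (π (Additive.ofMul g)) = π (Additive.ofMul k)) ∧
      ∀ U : AddSubgroup W, (∀ w ∈ U, T w ∈ U) → U = ⊥ ∨ U = ⊤ := by
  let C : Subgroup (endKer x) := (center G).subgroupOf (endKer x)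
  let _ : CommGroup (endKer x ⧸ C) := { (inferInstance : Group (endKer x ⧸ C)) with
    mul_comm := by
      intro a c
      induction a using QuotientGroup.induction_on with
      | H a =>
      induction c using QuotientGroup.induction_on with
      | H c =>
      rw [← QuotientGroup.mk_mul, ← QuotientGroup.mk_mul, QuotientGroup.eq]
      have := h.commutator_commute (inv_mem c.2) (inv_mem a.2)
      rw [mem_subgroupOf]
      convert this using 1
      push_cast
      group }
  let π : Additive (endKer x) →+ Additive (endKer x ⧸ C) :=
    MonoidHom.toAdditive (QuotientGroup.mk' C)
  have hπs : Function.Surjective π := QuotientGroup.mk'_surjective C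
  have hπ0 : ∀ g : endKer x, π (Additive.ofMul g) = 0 ↔ (g : G) ∈ center G := fun g =>
    (QuotientGroup.eq_one_iff (N := C) g).trans mem_subgroupOf
  have hconj : ∀ g : endKer x, b * g * b⁻¹ ∈ endKer x := fun g =>
    Normal.conj_mem inferInstance _ g.2 b
  let f : endKer x →* endKer x :=
    ((MulAut.conj b).toMonoidHom.comp (endKer x).subtype).codRestrict (endKer x) hconj
  have hf : ∀ g : endKer x, ((f g : endKer x) : G) = b * g * b⁻¹ := fun g => rfl
  obtain ⟨T, hT⟩ := π.exists_end_of_surjective hπs (MonoidHom.toAdditive f) (fun a ha => by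
    refine (hπ0 (f a.toMul)).2 ?_
    rw [hf]
    exact Normal.conj_mem inferInstance _ ((hπ0 a.toMul).1 ha) b)
  have hTf : ∀ g : endKer x, T (π (Additive.ofMul g)) = π (Additive.ofMul (f g)) := fun g => hT _
  refine ⟨Additive (endKer x ⧸ C), inferInstance, inferInstanceAs (Finite (endKer x ⧸ C)), π, T,
    hπs, hπ0, ?_, ?_, ?_, ?_⟩
  · intro w
    obtain ⟨g, rfl⟩ := hπs w
    rw [← map_nsmul]
    exact (hπ0 (g.toMul ^ p)).2 (h.pow_mem_center_of_mem g.toMul.2)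
  · have hC : (centralizer {b}).subgroupOf (endKer x) = C := by
      ext g
      rw [mem_subgroupOf, mem_subgroupOf, h.mem_center_iff_commute g.2,
        mem_centralizer_singleton_iff]
    rw [ncard_conjOrbit, relIndex, hC]
    rfl
  · intro g k hk
    rw [hTf]
    exact congrArg (fun k => π (Additive.ofMul k)) (Subtype.ext ((hf g).trans hk.symm))
  · intro U hU
    let U' : Subgroup (endKer x) :=
      { carrier := {g | π (Additive.ofMul g) ∈ U}
        mul_mem' := fun {g k} hg hk => U.add_mem hg hk
        one_mem' := U.zero_mem
        inv_mem' := fun {g} hg => U.neg_mem hg }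
    have hU' : ∀ g : endKer x, g ∈ U' ↔ π (Additive.ofMul g) ∈ U := fun g => Iff.rfl
    -- A proper preimage is normalized by `b`, hence centralized by `b`, hence central: it is zero
    -- in the quotient.
    by_cases hne : U'.map (endKer x).subtype = endKer x
    · right
      refine eq_top_iff.2 fun w _ => ?_
      obtain ⟨g, rfl⟩ := hπs w
      obtain ⟨k, hk, hkg⟩ := hne.ge g.toMul.2
      have hkg' : k = g.toMul := Subtype.ext hkg
      rw [hkg'] at hk
      exact hk
    · left
      refine (AddSubgroup.eq_bot_iff_forall _).2 fun w hw => ?_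
      obtain ⟨g, rfl⟩ := hπs w
      refine (hπ0 g.toMul).2 ((h.mem_center_iff_commute g.toMul.2).2
        (h.commute_of_ne (map_subtype_le U') ?_ hne (mem_map_of_mem _ hw)))
      rintro _ ⟨k, hk, rfl⟩
      refine ⟨f k, ?_, rfl⟩
      have := hU _ hk
      rwa [hTf] at this

/-- Upper bound: the module is irreducible, and `T ^ q = 1` since `b ^ q` is central. Lower bound:
the count is a nontrivial power of `p` congruent to `1` modulo `q`, so its exponent is a positive
multiple of `u`. -/
theorem ncard_conjOrbit_eq (h : IsSchmidtRetraction p q v x b) :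
    (conjOrbit b (endKer x)).ncard = p ^ orderOf (p : ZMod q) := by
  have : Fact p.Prime := ⟨h.prime_left⟩
  refine le_antisymm ?_ ?_
  · obtain ⟨W, _, _, π, T, hπs, hπ0, hpW, hcard, hT, hirr⟩ := h.exists_module
    rw [← hcard]
    refine natCard_le_of_irreducible h.prime_left h.prime_right h.ne hpW (T := T) ?_ hirr
    have hpow : ∀ (n : ℕ) (g k : endKer x), (k : G) = b ^ n * g * (b ^ n)⁻¹ →
        (T ^ n) (π (Additive.ofMul g)) = π (Additive.ofMul k) := by
      intro n
      induction n with
      | zero =>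
        intro g k hk
        rw [pow_zero, one_mul, inv_one, mul_one] at hk
        rw [Subtype.ext hk]
        rfl
      | succ n ih =>
        intro g k hk
        rw [pow_succ]
        change (T ^ n) (T _) = _
        rw [hT g ⟨b * g * b⁻¹, Normal.conj_mem inferInstance _ g.2 b⟩ rfl]
        refine ih _ _ (hk.trans ?_)
        rw [pow_succ]
        group
    refine DFunLike.ext _ _ fun w => ?_
    obtain ⟨g, rfl⟩ := hπs w
    refine hpow q g.toMul g.toMul ?_
    rw [← mem_center_iff.1 h.pow_mem_center, mul_inv_cancel_right]
  · obtain ⟨n, -, hn⟩ := (Nat.dvd_prime_pow h.prime_left).1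
      ((centralizer {b}).relIndex_dvd_card (endKer x) |>.trans
        (IsPGroup.iff_card.1 h.isPGroup).choose_spec.dvd)
    rw [← ncard_conjOrbit] at hn
    have hmod := h.ncard_conjOrbit_modEq h.prime_right (P := endKer x)
      (fun g hg => Normal.conj_mem inferInstance _ hg b)
    rw [hn] at hmod ⊢
    refine Nat.pow_le_pow_right h.prime_left.pos (Nat.le_of_dvd (Nat.pos_of_ne_zero ?_)
      (Nat.Prime.orderOf_dvd_of_pow_modEq hmod))
    rintro rfl
    rw [pow_zero, ncard_conjOrbit, relIndex_eq_one] at hn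
    exact h.not_forall_commute fun g hg => mem_centralizer_singleton_iff.1 (hn hg)

/-- An element `y` of order `p` in `D x` acts on the module as a map `S` commuting with `T`.
Irreducibility and `S ^ p = 1` force `S = 1`; then `y` is shown to fix the kernel pointwise, and it
already fixes `b`. -/
theorem not_dvd_natCard_D (h : IsSchmidtRetraction p q v x b) : ¬ p ∣ Nat.card (D x) := by
  intro hdvd
  have : Fact p.Prime := ⟨h.prime_left⟩
  obtain ⟨⟨y, hyD⟩, hord⟩ := exists_prime_orderOf_dvd_card' (G := D x) p hdvd
  have hyp : y ^ p = 1 := by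
    have := pow_orderOf_eq_one (⟨y, hyD⟩ : D x)
    rw [hord] at this
    exact congrArg Subtype.val this
  have hyb : y b = b := (h.mem_D_iff.1 hyD).2
  have hyx : ∀ g, y (x g) = x g := DFunLike.congr_fun hyD.2
  have hxy : ∀ g, x (y g) = x g := DFunLike.congr_fun hyD.1
  have hyN : ∀ g ∈ endKer x, y g ∈ endKer x := fun g hg => by
    rw [mem_endKer, hxy, mem_endKer.1 hg]
  have hyC : ∀ g ∈ center G, y g ∈ center G := fun g hg => by
    rw [mem_center_iff]
    intro k
    rw [← y.apply_symm_apply k, ← map_mul, mem_center_iff.1 hg, map_mul]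
  obtain ⟨W, _, _, π, T, hπs, hπ0, hpW, hcard, hT, hirr⟩ := h.exists_module
  let f : endKer x →* endKer x :=
    (y.toMonoidHom.comp (endKer x).subtype).codRestrict (endKer x) fun g => hyN g g.2
  have hf : ∀ g : endKer x, ((f g : endKer x) : G) = y g := fun g => rfl
  obtain ⟨S, hS⟩ := π.exists_end_of_surjective hπs (MonoidHom.toAdditive f) (fun a ha =>
    (hπ0 (f a.toMul)).2 (hyC _ ((hπ0 a.toMul).1 ha)))
  have hSf : ∀ g k : endKer x, (k : G) = y g →
      S (π (Additive.ofMul g)) = π (Additive.ofMul k) := fun g k hk =>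
    (hS _).trans (congrArg (fun k => π (Additive.ofMul k)) (Subtype.ext ((hf g).trans hk.symm)))
  have hpow : ∀ (n : ℕ) (g k : endKer x), (k : G) = (y ^ n) g →
      (S ^ n) (π (Additive.ofMul g)) = π (Additive.ofMul k) := by
    intro n
    induction n with
    | zero =>
      intro g k hk
      rw [Subtype.ext hk]
      rfl
    | succ n ih =>
      intro g k hk
      rw [pow_succ]
      change (S ^ n) (S _) = _
      rw [hSf g ⟨y g, hyN g g.2⟩ rfl]
      refine ih _ _ (hk.trans ?_)
      rw [pow_succ]
      rfl
  have hSp : S ^ p = 1 := by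
    refine DFunLike.ext _ _ fun w => ?_
    obtain ⟨g, rfl⟩ := hπs w
    refine hpow p g.toMul g.toMul ?_
    rw [hyp]
    rfl
  have hfix : ∀ w, S w = w := by
    let U : AddSubgroup W :=
      { carrier := {w | S w = w}
        add_mem' := fun {w t} hw ht => by
          change S (w + t) = w + t
          rw [map_add, show S w = w from hw, show S t = t from ht]
        zero_mem' := map_zero S
        neg_mem' := fun {w} hw => by
          change S (-w) = -w
          rw [map_neg, show S w = w from hw] }
    have hU : ∀ w, w ∈ U ↔ S w = w := fun w => Iff.rfl
    have hcomm : ∀ w, S (T w) = T (S w) := by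
      intro w
      obtain ⟨g, rfl⟩ := hπs w
      have hb := fun g : endKer x => Normal.conj_mem (H := endKer x) inferInstance _ g.2 b
      refine (congrArg S (hT g.toMul ⟨_, hb g.toMul⟩ rfl)).trans ?_
      refine Eq.trans ?_ (congrArg T (hSf g.toMul ⟨_, hyN _ g.toMul.2⟩ rfl)).symm
      rw [hT _ ⟨_, hb _⟩ rfl, hSf _ _ ?_]
      simp only [map_mul, map_inv, hyb]
    rcases hirr U (fun w hw => by rw [hU, hcomm, (hU w).1 hw]) with hbot | htop
    · have hsub := subsingleton_of_pow_eq_one h.prime_left hpW hSp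
        fun w hw => AddSubgroup.mem_bot.1 (hbot ▸ (hU w).2 hw)
      exact fun w => hsub.elim _ _
    · exact fun w => (hU w).1 (htop ▸ AddSubgroup.mem_top w)
  have hyc : ∀ g ∈ endKer x, g⁻¹ * y g ∈ center G := by
    intro g hg
    rw [← hπ0 ⟨g⁻¹ * y g, mul_mem (inv_mem hg) (hyN g hg)⟩]
    have h1 := (hSf ⟨g, hg⟩ ⟨y g, hyN g hg⟩ rfl).symm.trans (hfix _)
    have h2 := map_add π (Additive.ofMul (⟨g, hg⟩ : endKer x)⁻¹)
      (Additive.ofMul (⟨y g, hyN g hg⟩ : endKer x))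
    rw [h1, ofMul_inv, map_neg, neg_add_cancel] at h2
    exact h2
  let P : Subgroup G := endKer x ⊓ (y.toMonoidHom.eqLocus (MonoidHom.id G))
  have hP : ∀ g, g ∈ P ↔ g ∈ endKer x ∧ y g = g := fun g => Iff.rfl
  -- As `y` moves `g` only by a central factor, it fixes `g⁻¹ * b * g * b⁻¹`. If the fixed subgroup
  -- `P` were proper, `b` would commute with all these commutators, hence with the kernel.
  have hPN : P = endKer x := by
    by_contra hne
    refine h.not_forall_commute fun g hg =>
      (h.commute_of_commutator_commute h.prime_right ?_).symm
    have h1 : g⁻¹ * b * g * b⁻¹ ∈ P := by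
      refine (hP _).2 ⟨?_, ?_⟩
      · rw [mul_assoc, mul_assoc, ← mul_assoc b]
        exact mul_mem (inv_mem hg) (Normal.conj_mem inferInstance g hg b)
      · have h2 := mem_center_iff.1 (hyc g hg)
        have h3 : y g = g * (g⁻¹ * y g) := by group
        set c := g⁻¹ * y g
        rw [map_mul, map_mul, map_mul, map_inv, map_inv, hyb, h3, mul_inv_rev]
        calc c⁻¹ * g⁻¹ * b * (g * c) * b⁻¹ = c⁻¹ * ((g⁻¹ * b * g) * c) * b⁻¹ := by group
          _ = c⁻¹ * (c * (g⁻¹ * b * g)) * b⁻¹ := by rw [h2]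
          _ = _ := by group
    have h2 := h.commute_of_ne inf_le_left (fun k hk => (hP _).2
      ⟨Normal.conj_mem inferInstance k hk.1 b, by
        rw [map_mul, map_mul, map_inv, hyb, ((hP k).1 hk).2]⟩) hne h1
    have h3 := (show Commute _ b from h2).mul_left (Commute.refl b)
    rw [inv_mul_cancel_right] at h3
    exact h3.symm
  have hy1 : y = 1 := by
    refine MulEquiv.ext fun g => ?_
    have h1 := ((hP _).1 (hPN.ge (h.mul_inv_mem g))).2
    rw [map_mul, map_inv, hyx] at h1
    exact mul_right_cancel h1
  have : (⟨y, hyD⟩ : D x) = 1 := Subtype.ext hy1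
  rw [this, orderOf_one] at hord
  exact h.prime_left.one_lt.ne hord

/-- Orbit and stabilizer: `V x` sends `b` to exactly its conjugates, the inner automorphisms lying
in `V x`. -/
theorem natCard_V (h : IsSchmidtRetraction p q v x b) :
    Nat.card (V x) = p ^ orderOf (p : ZMod q) * Nat.card (D x) := by
  have hDV : D x ≤ V x := fun y hy => hy.1
  have horb : MulAction.orbit (V x) b = conjOrbit b ⊤ := by
    ext c
    constructor
    · rintro ⟨⟨y, hy⟩, rfl⟩
      obtain ⟨g, hg⟩ := h.exists_eq_conj h.prime_right (c := y b) (m := v)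
        (by rw [← map_pow, h.pow_orderOf, map_one])
        (by rw [apply_mulAut_of_mem_V hy, h.apply_self])
      exact ⟨g, trivial, hg.symm⟩
    · rintro ⟨g, -, rfl⟩
      exact ⟨⟨MulAut.conj g, h.conj_mem_V g⟩, rfl⟩
  have hstab : MulAction.stabilizer (V x) b = (D x).subgroupOf (V x) := by
    ext y
    rw [mem_subgroupOf, h.mem_D_iff]
    exact ⟨fun hy => ⟨y.2, hy⟩, fun hy => hy.2⟩
  rw [← h.ncard_conjOrbit_eq, ← h.conjOrbit_top, ← horb, ← MulAction.index_stabilizer, hstab,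
    ← Nat.card_congr (subgroupOfEquivOfLe hDV).toEquiv, mul_comm, card_mul_index]

/-- Conjugations by elements of the kernel form a copy of `N / (N ∩ Z(G))`. Its order `p ^ u` is the
full `p`-part of the order of `V x`, so it is a Sylow subgroup, and the others are isomorphic to it.
-/
theorem isElementaryAbelian_sylow (h : IsSchmidtRetraction p q v x b) (S : Sylow p (V x)) :
    IsElementaryAbelian p S ∧ Nat.card S = p ^ orderOf (p : ZMod q) := by
  have : Fact p.Prime := ⟨h.prime_left⟩
  have hcard : ∀ S : Sylow p (V x), Nat.card S = p ^ orderOf (p : ZMod q) := by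
    intro S
    rw [S.card_eq_multiplicity, h.natCard_V, Nat.factorization_mul
      (pow_pos h.prime_left.pos _).ne' Nat.card_pos.ne', Finsupp.add_apply,
      Nat.factorization_eq_zero_of_not_dvd h.not_dvd_natCard_D, h.prime_left.factorization_pow,
      Finsupp.single_eq_same, add_zero]
  let φ : endKer x →* V x :=
    ((MulAut.conj (G := G)).comp (endKer x).subtype).codRestrict (V x) fun g => h.conj_mem_V g
  have hφ : ∀ g : endKer x, φ g = 1 ↔ (g : G) ∈ center G := by
    intro g
    rw [Subtype.ext_iff, mem_center_iff]
    constructor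
    · intro hg k
      have : (g : G) * k * (g : G)⁻¹ = k := DFunLike.congr_fun hg k
      exact (mul_inv_eq_iff_eq_mul.1 this).symm
    · intro hg
      refine MulEquiv.ext fun k => ?_
      exact mul_inv_eq_iff_eq_mul.2 (hg k).symm
  have hφker : φ.ker = (centralizer {b}).subgroupOf (endKer x) := by
    ext g
    rw [MonoidHom.mem_ker, hφ, mem_subgroupOf, h.mem_center_iff_commute g.2,
      mem_centralizer_singleton_iff]
  have hφcard : Nat.card φ.range = p ^ orderOf (p : ZMod q) := by
    rw [← index_ker, hφker, ← h.ncard_conjOrbit_eq, ncard_conjOrbit, relIndex]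
  obtain ⟨R, hR⟩ := (IsPGroup.of_card hφcard).exists_le_sylow
  have hR' : φ.range = R := eq_of_le_of_card_ge hR (by rw [hφcard]; exact (hcard R).le)
  have hRab : IsElementaryAbelian p R := by
    have hlift : ∀ a : R, ∃ g : endKer x, φ g = a := fun a => hR'.ge a.2
    constructor
    · intro a c
      obtain ⟨g, hg⟩ := hlift a
      obtain ⟨k, hk⟩ := hlift c
      refine Subtype.ext ?_
      change (a : V x) * c = c * a
      have := (hφ (g * k * g⁻¹ * k⁻¹)).2 (h.commutator_commute g.2 k.2)
      rw [map_mul, map_mul, map_mul, map_inv, map_inv, mul_inv_eq_one, mul_inv_eq_iff_eq_mul]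
        at this
      rw [← hg, ← hk, this]
    · intro a
      obtain ⟨g, hg⟩ := hlift a
      refine Subtype.ext ?_
      change (a : V x) ^ p = 1
      rw [← hg, ← map_pow, hφ]
      exact h.pow_mem_center_of_mem g.2
  let e : S ≃* R := Sylow.equiv S R
  refine ⟨⟨fun a c => e.injective ?_, fun a => e.injective ?_⟩, hcard S⟩
  · rw [map_mul, map_mul, hRab.1]
  · rw [map_pow, map_one, hRab.2]

end IsSchmidtRetraction
end SchmidtEnd

/-! ### Endomorphisms of a Schmidt group -/

theorem nonempty_monoidEnd_mulEquiv {A B : Type*} [Monoid A] [Monoid B] (f : A ≃* B) :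
    Nonempty (Monoid.End A ≃* Monoid.End B) := by
  refine ⟨{
    toFun := fun g => (f.toMonoidHom.comp (g : A →* A)).comp f.symm.toMonoidHom
    invFun := fun g => (f.symm.toMonoidHom.comp (g : B →* B)).comp f.toMonoidHom
    left_inv := fun g => Monoid.End.ext _ fun a => ?_
    right_inv := fun g => Monoid.End.ext _ fun a => ?_
    map_mul' := fun g k => Monoid.End.ext _ fun a => ?_ }⟩
  · change f.symm (f (g (f.symm (f a)))) = g a
    rw [f.symm_apply_apply, f.symm_apply_apply]
  · change f (f.symm (g (f (f.symm a)))) = g a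
    rw [f.apply_symm_apply, f.apply_symm_apply]
  · change f (g (k (f.symm a))) = f (g (f.symm (f (k (f.symm a)))))
    rw [f.symm_apply_apply]

namespace SchmidtEnd

theorem injective_of_mem_autSet {G : Type*} [Group G] {z : Monoid.End G} (hz : z ∈ autSet G) :
    Function.Injective z := by
  obtain ⟨y, rfl⟩ := hz
  exact y.injective

theorem mem_autSet_of_injective {G : Type*} [Group G] [Finite G] {z : Monoid.End G}
    (hz : Function.Injective z) : z ∈ autSet G :=
  ⟨MulEquiv.ofBijective (z : G →* G) (Finite.injective_iff_bijective.1 hz),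
    Monoid.End.ext _ fun _ => rfl⟩

theorem K_disjoint_autSet {G : Type*} [Group G] {y z : Monoid.End G} (hy : y ∈ I₀ G)
    (hz : z ∈ K y) : z ∉ autSet G := fun h =>
  hy.2.2 (Monoid.End.ext _ fun g =>
    injective_of_mem_autSet h (DFunLike.congr_fun hz.2 g))

namespace IsCoprimeRetraction

variable {G : Type u} [Group G] {q v : ℕ} {x : Monoid.End G} {b : G}

theorem endKer_le_of_mem_K (h : IsCoprimeRetraction q v x b) {y z : Monoid.End G}
    (hy : y ∈ idemClass x) (hz : z ∈ K y) : endKer x ≤ endKer z := fun n hn => by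
  have h1 : z (y n) = z n := DFunLike.congr_fun hz.2 n
  have h2 : y n = 1 := mem_endKer.1 ((h.of_mem_idemClass hy).1.ge hn)
  rw [mem_endKer, ← h1, h2, map_one]

/-- Since `y b` generates the image of `y`, membership in `K y` for `y ∈ [x]` becomes a question
about the single element `z b` once `z` kills the kernel. -/
theorem mem_K_iff (h : IsCoprimeRetraction q v x b) {y z : Monoid.End G}
    (hy : y ∈ idemClass x) :
    z ∈ K y ↔ endKer x ≤ endKer z ∧ z b ∈ zpowers (y b) := by
  obtain ⟨hker, hxy, hyy⟩ := h.of_mem_idemClass hy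
  constructor
  · intro hz
    refine ⟨h.endKer_le_of_mem_K hy hz, ?_⟩
    have h1 : y (z b) = z b := DFunLike.congr_fun hz.1 b
    obtain ⟨k, hk⟩ := mem_zpowers_iff.1 (h.apply_mem (z b))
    rw [← h1, h.apply_eq_of_le_ker hker.ge (z b), ← hk, map_zpow]
    exact zpow_mem (mem_zpowers _) k
  · rintro ⟨hz, hzb⟩
    obtain ⟨k, hk⟩ := mem_zpowers_iff.1 hzb
    constructor
    · refine h.end_ext (fun n hn => ?_) hz ?_
      · change y (z n) = 1
        rw [mem_endKer.1 (hz hn), map_one]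
      · change y (z b) = z b
        rw [← hk, map_zpow, hyy]
    · refine h.end_ext (fun n hn => ?_) hz ?_
      · change z (y n) = 1
        rw [mem_endKer.1 (hker.ge hn), map_one]
      · change z (y b) = z b
        rw [h.apply_eq_of_le_ker hz, hxy]

/-- An element of `H x` kills the kernel and sends `b` to a `q`-element of the kernel, which is
trivial. -/
theorem H_eq (h : IsCoprimeRetraction q v x b) (hq : q.Prime) : H x = {zeroEnd G} := by
  ext y
  constructor
  · rintro ⟨h1, h2⟩
    have hy : endKer x ≤ endKer y := fun n hn => by
      have : y (x n) = y n := DFunLike.congr_fun h1 n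
      rw [mem_endKer, ← this, mem_endKer.1 hn, map_one]
    refine h.end_ext hy (fun n _ => rfl) ?_
    refine h.eq_one_of_pow hq (m := v) (DFunLike.congr_fun h2 b) ?_
    rw [← map_pow, h.pow_orderOf, map_one]
  · rintro rfl
    exact ⟨rfl, Monoid.End.ext _ fun g => map_one x⟩

theorem nonempty_K_mulEquiv (h : IsCoprimeRetraction q v x b) :
    Nonempty (K x ≃* Monoid.End (Multiplicative (ZMod (q ^ v)))) := by
  obtain ⟨e⟩ := SchmidtEnd.nonempty_K_mulEquiv h.apply_mem fun g hg => h.apply_of_mem hg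
  have hcard : Nat.card (zpowers b) = Nat.card (Multiplicative (ZMod (q ^ v))) := by
    rw [Nat.card_zpowers, h.orderOf_eq]
    exact (Nat.card_zmod _).symm
  let f : zpowers b ≃* Multiplicative (ZMod (q ^ v)) := mulEquivOfCyclicCardEq hcard
  obtain ⟨e'⟩ := nonempty_monoidEnd_mulEquiv f
  exact ⟨e.trans e'⟩

end IsCoprimeRetraction

namespace IsSchmidtRetraction

variable {G : Type u} [Group G] {p q v : ℕ} {x : Monoid.End G} {b : G}

theorem ne_one (h : IsSchmidtRetraction p q v x b) : b ≠ 1 := fun hb => by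
  have := h.orderOf_eq
  rw [hb, orderOf_one] at this
  exact (Nat.one_lt_pow (Nat.one_le_iff_ne_zero.1 h.one_le) h.prime_right.one_lt).ne this

variable [Finite G]

/-- Every endomorphism of a Schmidt group that is not an automorphism is trivial on the derived
subgroup. -/
theorem endKer_le_of_notMem_autSet (h : IsSchmidtRetraction p q v x b) {z : Monoid.End G}
    (hz : z ∉ autSet G) : endKer x ≤ endKer z := by
  let L : Subgroup G := (z : G →* G).range
  have hL : ∀ g, z g ∈ L := fun g => ⟨g, rfl⟩
  have hLtop : L ≠ ⊤ := fun htop => hz (mem_autSet_of_injective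
    (Finite.injective_iff_surjective.2 fun g => htop.ge (mem_top g)))
  have hcomm : ∀ g ∈ endKer x, z g * z b = z b * z g := by
    intro g hg
    obtain ⟨k, hk⟩ := h.exists_pow hg
    exact congrArg Subtype.val ((h.isNilpotent L hLtop).commute_of_pow_eq_one h.prime_left
      h.prime_right h.ne (a := ⟨z g, hL g⟩) (b := ⟨z b, hL b⟩) (m := k) (n := v)
      (Subtype.ext ((map_pow z g _).symm.trans (by rw [hk, map_one]; rfl)))
      (Subtype.ext ((map_pow z b _).symm.trans (by rw [h.pow_orderOf, map_one]; rfl))))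
  -- Since `z g` and `z b` commute, `z` kills `g⁻¹ * b * g * b⁻¹`. If `endKer x ⊓ endKer z` is
  -- proper in the kernel, `b` commutes with these commutators, hence with the kernel.
  by_contra hle
  refine h.not_forall_commute fun g hg =>
    (h.commute_of_commutator_commute h.prime_right ?_).symm
  have h1 : g⁻¹ * b * g * b⁻¹ ∈ endKer x ⊓ endKer z := by
    constructor
    · rw [mul_assoc, mul_assoc, ← mul_assoc b]
      exact Subgroup.mul_mem _ (Subgroup.inv_mem _ hg) (Normal.conj_mem inferInstance g hg b)
    · change z (g⁻¹ * b * g * b⁻¹) = 1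
      rw [map_mul, map_mul, map_mul, map_inv, map_inv, mul_assoc (z g)⁻¹, ← hcomm g hg]
      group
  have h2 := h.commute_of_ne inf_le_left (fun k hk =>
    ⟨Normal.conj_mem inferInstance k hk.1 b, Normal.conj_mem inferInstance k hk.2 b⟩)
    (fun heq => hle (inf_eq_left.1 heq)) h1
  have h3 := (show Commute _ b from h2).mul_left (Commute.refl b)
  rw [inv_mul_cancel_right] at h3
  exact h3.symm

theorem I₀_eq (h : IsSchmidtRetraction p q v x b) : I₀ G = idemClass x := by
  ext y
  constructor
  · rintro ⟨h1, h2, h3⟩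
    have hidem : ∀ g, y (y g) = y g := DFunLike.congr_fun h1
    have hy : endKer x ≤ endKer y := h.endKer_le_of_notMem_autSet fun hy =>
      h3 (Monoid.End.ext _ fun g => injective_of_mem_autSet hy (hidem g))
    have hyb : y b ≠ 1 := fun hyb => h2 (h.end_ext hy (fun n _ => rfl) hyb)
    -- Idempotence gives `q ^ v ∣ k * (k - 1)`. The order of `y b`, a nontrivial power of `q`,
    -- divides `k - 1`, so `q ∤ k`; hence `b ^ k = b`.
    obtain ⟨k, hk⟩ := mem_zpowers_iff.1 (h.apply_mem (y b))
    have hyk : y b ^ k = y b := by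
      rw [← map_zpow, hk, ← h.apply_eq_of_le_ker hy, hidem]
    have hxk : (b ^ k) ^ k = b ^ k := by
      rw [hk, ← map_zpow, hyk]
    have hqk : IsCoprime k ((q ^ v : ℕ) : ℤ) := by
      rw [Nat.cast_pow]
      refine IsCoprime.pow_right ((Nat.prime_iff_prime_int.1 h.prime_right).coprime_iff_not_dvd.2
        fun hdvd => ?_).symm
      have h4 : ((orderOf (y b) : ℕ) : ℤ) ∣ k - 1 := by
        rw [orderOf_dvd_iff_zpow_eq_one, zpow_sub_one, hyk, mul_inv_cancel]
      have h5 : orderOf (y b) ∣ q ^ v := orderOf_dvd_of_pow_eq_one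
        (by rw [← map_pow, h.pow_orderOf, map_one])
      obtain ⟨i, -, hi⟩ := (Nat.dvd_prime_pow h.prime_right).1 h5
      have hi0 : i ≠ 0 := by
        rintro rfl
        exact hyb (orderOf_eq_one_iff.1 hi)
      have h6 : (q : ℤ) ∣ k - 1 :=
        (Int.natCast_dvd_natCast.2 ((dvd_pow_self q hi0).trans hi.symm.dvd)).trans h4
      have h7 : (q : ℤ) ∣ 1 := by
        have := dvd_sub hdvd h6
        rwa [sub_sub_cancel] at this
      exact (Nat.prime_iff_prime_int.1 h.prime_right).not_isUnit (isUnit_of_dvd_one h7)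
    have hxy : x (y b) = b := by
      have h4 : ((orderOf b : ℕ) : ℤ) ∣ k * (k - 1) := by
        rw [orderOf_dvd_iff_zpow_eq_one, mul_sub_one, zpow_sub, zpow_mul, hxk, mul_inv_cancel]
      rw [h.orderOf_eq] at h4
      have h5 := hqk.symm.dvd_of_dvd_mul_left h4
      rw [← h.orderOf_eq, orderOf_dvd_iff_zpow_eq_one, zpow_sub_one, mul_inv_eq_one, hk] at h5
      exact h5
    refine ⟨h1, Monoid.End.ext _ fun g => (h.apply_eq_of_le_ker hy g).symm,
      h.end_ext (fun n hn => ?_) le_rfl (hxy.trans h.apply_self.symm)⟩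
    change x (y n) = 1
    rw [mem_endKer.1 (hy hn), map_one]
  · intro hy
    obtain ⟨hker, hxy, -⟩ := h.of_mem_idemClass hy
    refine ⟨hy.1, ?_, ?_⟩
    · rintro rfl
      exact h.ne_one (hxy.symm.trans (map_one x))
    · rintro rfl
      refine h.not_forall_commute fun g hg => ?_
      have : g = 1 := mem_endKer.1 (hker.ge hg)
      rw [this, one_mul, mul_one]

theorem mem_I₀ (h : IsSchmidtRetraction p q v x b) : x ∈ I₀ G := by
  rw [h.I₀_eq]
  have hidem : x * x = x := Monoid.End.ext _ h.apply_apply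
  exact ⟨hidem, hidem, hidem⟩

theorem exists_mem_K (h : IsSchmidtRetraction p q v x b) {z : Monoid.End G}
    (hz : z ∉ autSet G) : ∃ y ∈ I₀ G, z ∈ K y := by
  rw [h.I₀_eq]
  obtain ⟨g, hg⟩ := h.exists_mem_zpowers_conj h.prime_right (c := z b) (m := v)
    (by rw [← map_pow, h.pow_orderOf, map_one])
  obtain ⟨y, hy, hyb⟩ := h.exists_mem_idemClass g
  exact ⟨y, hy, (h.mem_K_iff hy).2 ⟨h.endKer_le_of_notMem_autSet hz, hyb ▸ hg⟩⟩

theorem compl_autSet (h : IsSchmidtRetraction p q v x b) :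
    Set.univ \ autSet G = ⋃ y ∈ I₀ G, (K y : Set (Monoid.End G)) := by
  ext z
  simp only [Set.mem_sdiff, Set.mem_univ, true_and, Set.mem_iUnion, SetLike.mem_coe, exists_prop]
  exact ⟨h.exists_mem_K, fun ⟨y, hy, hz⟩ => K_disjoint_autSet hy hz⟩

/-- Both sides say that `z` kills the kernel and `z b ∈ ⟨b ^ q⟩`. If `z b` generated `⟨b⟩`, all
conjugates of `⟨b⟩` would coincide and `b` would centralize the kernel. For `z b = b ^ k`, `z ^ v`
sends `b` to `b ^ k ^ v`, which is trivial exactly when `q ∣ k`. -/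
theorem mem_iInter_K_iff (h : IsSchmidtRetraction p q v x b) (z : Monoid.End G) :
    z ∈ ⋂ y ∈ I₀ G, (K y : Set (Monoid.End G)) ↔ z ^ v = zeroEnd G := by
  simp only [Set.mem_iInter, SetLike.mem_coe]
  have hv : v ≠ 0 := Nat.one_le_iff_ne_zero.1 h.one_le
  constructor
  · intro hz
    have hzx := (h.mem_K_iff (h.I₀_eq ▸ h.mem_I₀)).1 (hz x h.mem_I₀)
    rw [h.apply_self] at hzx
    obtain ⟨hker, hzb⟩ := hzx
    obtain ⟨k, hk⟩ := mem_zpowers_iff.1 hzb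
    have hqk : (q : ℤ) ∣ k := by
      by_contra hqk
      have hcop : IsCoprime ((q ^ v : ℕ) : ℤ) k := by
        rw [Nat.cast_pow]
        exact ((Nat.prime_iff_prime_int.1 h.prime_right).coprime_iff_not_dvd.2 hqk).pow_left
      obtain ⟨i, j, hij⟩ := hcop
      have hb : b ∈ zpowers (z b) := by
        refine mem_zpowers_iff.2 ⟨j, ?_⟩
        rw [← hk, ← zpow_mul, mul_comm, eq_sub_of_add_eq' hij, zpow_sub, zpow_one, mul_comm i,
          zpow_mul, zpow_natCast, h.pow_orderOf, one_zpow, inv_one, mul_one]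
      refine h.not_forall_commute fun g hg => ?_
      obtain ⟨y, hy, hyb⟩ := h.exists_mem_idemClass g
      have h1 := ((h.mem_K_iff hy).1 (hz y (h.I₀_eq ▸ hy))).2
      rw [hyb] at h1
      obtain ⟨j, hj⟩ := mem_zpowers_iff.1 ((zpowers_le.2 h1) hb)
      have h2 := congrArg x hj
      rw [map_zpow, h.apply_conj, h.apply_self] at h2
      rw [conj_zpow, h2] at hj
      exact mul_inv_eq_iff_eq_mul.1 hj
    refine h.end_ext (fun n hn => ?_) (fun n _ => rfl) ?_
    · obtain ⟨m, rfl⟩ := Nat.exists_eq_succ_of_ne_zero hv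
      rw [mem_endKer, pow_succ]
      change (z ^ m) (z n) = 1
      rw [mem_endKer.1 (hker hn), map_one]
    · rw [end_pow_zpow_apply z hk.symm]
      change b ^ k ^ v = 1
      rw [← orderOf_dvd_iff_zpow_eq_one, h.orderOf_eq, Nat.cast_pow]
      exact pow_dvd_pow_of_dvd hqk v
  · intro hz
    have hna : z ∉ autSet G := by
      intro hza
      have hinj : Function.Injective (z ^ v) := by
        rw [Monoid.End.coe_pow]
        exact (injective_of_mem_autSet hza).iterate v
      refine h.ne_one (hinj ?_)
      rw [hz]
      rfl
    obtain ⟨y, hy, hzy⟩ := h.exists_mem_K hna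
    rw [h.I₀_eq] at hy
    obtain ⟨hker, hzb⟩ := (h.mem_K_iff hy).1 hzy
    obtain ⟨g, hg⟩ := h.exists_conj_of_mem_idemClass h.prime_right hy
    obtain ⟨k, hk⟩ := mem_zpowers_iff.1 hzb
    have hzy : z (y b) = z b := by
      rw [h.apply_eq_of_le_ker hker, (h.of_mem_idemClass hy).2.1]
    have hqk : (q : ℤ) ∣ k := by
      have h1 := end_pow_zpow_apply z (b := y b) (k := k) (hzy.trans hk.symm) v
      rw [hz, hg, conj_zpow] at h1
      have h2 : b ^ k ^ v = 1 := by
        have := h1.symm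
        change _ = 1 at this
        rwa [mul_inv_eq_one, mul_eq_left] at this
      rw [← orderOf_dvd_iff_zpow_eq_one, h.orderOf_eq, Nat.cast_pow] at h2
      exact (Nat.prime_iff_prime_int.1 h.prime_right).dvd_of_dvd_pow
        ((dvd_pow_self _ hv).trans h2)
    obtain ⟨j, rfl⟩ := hqk
    have hcent : ∀ g : G, g * b ^ q * g⁻¹ = b ^ q := fun g => by
      rw [mem_center_iff.1 h.pow_mem_center g, mul_inv_cancel_right]
    have hzb' : z b = (b ^ q) ^ j := by
      rw [← hk, hg, zpow_mul, zpow_natCast, conj_pow, hcent]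
    intro y' hy'
    rw [h.I₀_eq] at hy'
    refine (h.mem_K_iff hy').2 ⟨hker, ?_⟩
    obtain ⟨g', hg'⟩ := h.exists_conj_of_mem_idemClass h.prime_right hy'
    rw [hzb', hg', ← hcent g', ← conj_pow]
    exact zpow_mem (pow_mem (mem_zpowers _) q) j

end IsSchmidtRetraction

/-- A Schmidt group with parameters `p, q, v` retracts onto a Sylow `q`-subgroup with the derived
subgroup as kernel. -/
theorem IsSchmidtGroupWithParams.exists_retraction {G : Type u} [Group G] {p q v : ℕ}
    (h : IsSchmidtGroupWithParams p q v G) :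
    ∃ (x : Monoid.End G) (b : G), IsSchmidtRetraction p q v x b := by
  obtain ⟨⟨hfin, hnn, hmin⟩, hp, hq, hpq, hv, hP, b, hb, hcompl⟩ := h
  obtain ⟨e, he1, he2, he3⟩ := hcompl.exists_retraction
  have hker : endKer e = commutator G := Subgroup.ext fun g => he1 g
  have : Fact p.Prime := ⟨hp⟩
  obtain ⟨n, hn⟩ := IsPGroup.iff_card.1 hP
  refine ⟨e, b, ⟨he2, he3 b (mem_zpowers b), hb, ?_⟩, hp, hq, hpq, hv, ?_, hker.symm, hmin, hnn⟩
  · rw [hker, hn]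
    exact fun hdvd => hpq ((Nat.prime_dvd_prime_iff_eq hq hp).1 (hq.dvd_of_dvd_pow hdvd)).symm
  · rw [hker]
    exact hP

/-! ### From the conditions on endomorphisms to a Schmidt group -/

/-- If `K(x)` is the endomorphism semigroup of a cyclic group of order `q ^ v` and `H(x)` is
trivial, then `x` is a retraction onto a cyclic Sylow `q`-subgroup. -/
theorem exists_isCoprimeRetraction {G : Type u} [Group G] [Finite G] {q v : ℕ} (hq : q.Prime)
    (hv : 1 ≤ v) {x : Monoid.End G} (hx : IsIdempotentElem x)
    (hK : Nonempty (K x ≃* Monoid.End (Multiplicative (ZMod (q ^ v)))))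
    (hH : H x = {zeroEnd G}) : ∃ b, IsCoprimeRetraction q v x b := by
  have : Fact q.Prime := ⟨hq⟩
  let L : Subgroup G := (x : G →* G).range
  have hidem : ∀ g, x (x g) = x g := DFunLike.congr_fun hx
  have hmem : ∀ g, x g ∈ L := fun g => ⟨g, rfl⟩
  obtain ⟨e⟩ := nonempty_K_mulEquiv hmem (by rintro _ ⟨g, rfl⟩; exact hidem g)
  obtain ⟨e'⟩ := hK
  obtain ⟨hcyc, hcard⟩ := isCyclic_of_monoidEnd_mulEquiv
    (C := Multiplicative (ZMod (q ^ v))) hq (Nat.card_zmod _) (e.symm.trans e')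
  obtain ⟨⟨b, hbL⟩, hb⟩ := IsCyclic.exists_generator (α := L)
  have hord : orderOf b = q ^ v := by
    rw [← hcard, ← orderOf_eq_card_of_forall_mem_zpowers hb, ← orderOf_coe]
  have hxb : x b = b := by
    obtain ⟨g, rfl⟩ := hbL
    exact hidem g
  have hxmem : ∀ g, x g ∈ zpowers b := by
    intro g
    obtain ⟨k, hk⟩ := mem_zpowers_iff.1 (hb ⟨x g, hmem g⟩)
    exact mem_zpowers_iff.2 ⟨k, congrArg Subtype.val hk⟩
  refine ⟨b, hxmem, hxb, hord, fun hdvd => ?_⟩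
  obtain ⟨⟨n, hn⟩, hnq⟩ := exists_prime_orderOf_dvd_card' (G := endKer x) q hdvd
  rw [← orderOf_coe] at hnq
  -- An element `n` of order `q` in the kernel would give a nonzero element of `H x`, sending `b` to
  -- `n`.
  obtain ⟨z, hz, hzb⟩ := exists_end_of_orderOf_dvd hxmem hxb (c := n) (by
    rw [hord]
    exact hnq.dvd.trans (dvd_pow_self q (Nat.one_le_iff_ne_zero.1 hv)))
  have hzx : ∀ g, z (x g) = z g := by
    intro g
    have h1 : g * (x g)⁻¹ ∈ endKer x := by
      rw [mem_endKer, map_mul, map_inv, hidem, mul_inv_cancel]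
    have h2 := mem_endKer.1 (hz h1)
    rw [map_mul, map_inv, mul_inv_eq_one] at h2
    exact h2.symm
  have hzH : z ∈ H x := by
    refine ⟨Monoid.End.ext _ hzx, Monoid.End.ext _ fun g => ?_⟩
    change x (z g) = 1
    obtain ⟨k, hk⟩ := mem_zpowers_iff.1 (hxmem g)
    rw [← hzx, ← hk, map_zpow, map_zpow, hzb, mem_endKer.1 hn, one_zpow]
  rw [hH] at hzH
  have hn1 : n = 1 := hzb.symm.trans (DFunLike.congr_fun (show z = zeroEnd G from hzH) b)
  change orderOf n = q at hnq
  rw [hn1, orderOf_one] at hnq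
  exact hq.one_lt.ne hnq

namespace IsCoprimeRetraction

variable {G : Type u} [Group G] {p q v : ℕ} {x : Monoid.End G} {b : G}

/-- A suitable power of `m` is a `q`-element with image `b` under `x`, hence a conjugate of `b`. In
the exponent `N * j`, the factor `N` makes it a `q`-element and the Bézout coefficient `j` makes its
image `b`. -/
theorem exists_conj_mem [Finite G] (h : IsCoprimeRetraction q v x b) (hq : q.Prime) {L : Subgroup G}
    {m : G} (hm : m ∈ L) {k : ℤ} (hmk : x m = b ^ k) (hk : ¬ (q : ℤ) ∣ k) :
    ∃ g : G, g * b * g⁻¹ ∈ L := by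
  set N := Nat.card (endKer x)
  have hqZ := Nat.prime_iff_prime_int.1 hq
  have hcop : IsCoprime ((q ^ v : ℕ) : ℤ) (k * N) := by
    rw [Nat.cast_pow]
    refine (hqZ.coprime_iff_not_dvd.2 fun hdvd => ?_).pow_left
    rcases hqZ.dvd_or_dvd hdvd with h1 | h1
    · exact hk h1
    · exact h.not_dvd (Int.natCast_dvd_natCast.1 h1)
  obtain ⟨i, j, hij⟩ := hcop
  have h1 : m ^ q ^ v ∈ endKer x := by
    rw [mem_endKer, map_pow, hmk, ← zpow_natCast, ← zpow_mul, mul_comm, zpow_mul, zpow_natCast,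
      h.pow_orderOf, one_zpow]
  have h2 : (m ^ q ^ v) ^ N = 1 := by
    have := pow_card_eq_one' (x := (⟨_, h1⟩ : endKer x))
    exact congrArg Subtype.val this
  have h3 : (m ^ ((N : ℤ) * j)) ^ q ^ v = 1 := by
    rw [← zpow_natCast, ← zpow_mul, mul_right_comm, mul_comm (N : ℤ), zpow_mul, zpow_mul,
      zpow_natCast, zpow_natCast, h2, one_zpow]
  have h4 : x (m ^ ((N : ℤ) * j)) = b := by
    have h5 : k * (N * j) = 1 + ((q ^ v : ℕ) : ℤ) * (-i) := by linear_combination hij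
    rw [map_zpow, hmk, ← zpow_mul, h5, zpow_add, zpow_one, zpow_mul, zpow_natCast, h.pow_orderOf,
      one_zpow, mul_one]
  obtain ⟨g, hg⟩ := h.exists_eq_conj hq h3 h4
  exact ⟨g, hg ▸ zpow_mem hm _⟩

theorem le_endKer_of_isPGroup (h : IsCoprimeRetraction q v x b) (hp : p.Prime) (hq : q.Prime)
    (hpq : p ≠ q) {P : Subgroup G} (hP : IsPGroup p P) : P ≤ endKer x := by
  intro g hg
  obtain ⟨k, hk⟩ := hP ⟨g, hg⟩
  have hk : g ^ p ^ k = 1 := congrArg Subtype.val hk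
  have h1 : orderOf (x g) ∣ p ^ k := orderOf_dvd_of_pow_eq_one (by rw [← map_pow, hk, map_one])
  have h2 : orderOf (x g) ∣ q ^ v := h.orderOf_eq ▸ orderOf_dvd_of_mem_zpowers (h.apply_mem g)
  exact orderOf_eq_one_iff.1 (Nat.eq_one_of_dvd_coprimes
    (((Nat.coprime_primes hp hq).2 hpq).pow k v) h1 h2)

/-- By a Frattini argument, `b` normalizes some Sylow `p`-subgroup. -/
theorem exists_sylow_normalized [Finite G] (h : IsCoprimeRetraction q v x b) (hp : p.Prime) (hq : q.Prime)
    (hpq : p ≠ q) : ∃ P : Sylow p G, ∀ g ∈ P, b * g * b⁻¹ ∈ P := by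
  have : Fact p.Prime := ⟨hp⟩
  obtain ⟨P⟩ : Nonempty (Sylow p G) := inferInstance
  have hPN : (P : Subgroup G) ≤ endKer x := h.le_endKer_of_isPGroup hp hq hpq P.2
  have htop := P.normalizer_sup_eq_top' hPN
  obtain ⟨m, hm, n, hn, hmn⟩ := mem_sup_of_normal_right.1 (htop.ge (mem_top b))
  have hxm : x m = b ^ (1 : ℤ) := by
    rw [zpow_one, ← h.apply_self, ← hmn, map_mul, mem_endKer.1 hn, mul_one]
  -- A conjugate of `b` lies in the normalizer of `P`; conjugating `P` back makes `b` itself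
  -- normalize a Sylow subgroup.
  obtain ⟨g, hg⟩ := h.exists_conj_mem hq hm hxm
    (fun hdvd => (Nat.prime_iff_prime_int.1 hq).not_isUnit (isUnit_of_dvd_one hdvd))
  have hmem : ∀ k, k ∈ g⁻¹ • P ↔ g * k * g⁻¹ ∈ P := by
    intro k
    change k ∈ ((g⁻¹ • P : Sylow p G) : Subgroup G) ↔ _
    rw [Sylow.coe_subgroup_smul, mem_pointwise_smul_iff_inv_smul_mem, map_inv, inv_inv]
    rfl
  refine ⟨g⁻¹ • P, fun k hk => ?_⟩
  rw [hmem] at hk ⊢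
  have := (mem_normalizer_iff.1 hg _).1 hk
  have heq : g * b * g⁻¹ * (g * k * g⁻¹) * (g * b * g⁻¹)⁻¹ = g * (b * k * b⁻¹) * g⁻¹ := by group
  exact heq ▸ this

theorem centralizer_index (hcard : (conjOrbit b ⊤).ncard = p ^ orderOf (p : ZMod q)) :
    (centralizer {b}).index = p ^ orderOf (p : ZMod q) := by
  rw [← hcard, ncard_conjOrbit, relIndex_top_right]

/-- When the class of `b` has `p ^ u` elements and the Sylow `p`-subgroups of `V(x)` have order
`p ^ u`, a Sylow `p`-subgroup meets the centralizer of `b` in its intersection with the center, and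
acts transitively on the class of `b`. -/
theorem sylow_inf_centralizer [Finite G] (h : IsCoprimeRetraction q v x b) (hp : p.Prime)
    (hcard : (conjOrbit b ⊤).ncard = p ^ orderOf (p : ZMod q))
    (hV : ∀ S : Sylow p (V x), Nat.card S = p ^ orderOf (p : ZMod q)) (P : Sylow p G) :
    (∀ g ∈ P, g * b = b * g → g ∈ center G) ∧ conjOrbit b P = conjOrbit b ⊤ := by
  have : Fact p.Prime := ⟨hp⟩
  set w := orderOf (p : ZMod q)
  -- `P / (P ∩ Z(G))` embeds in `V x` by conjugation, so a Sylow subgroup of `V x` bounds its order.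
  have hle : (center G).relIndex P ≤ p ^ w := by
    let φ : P →* V x := ((MulAut.conj (G := G)).comp (P : Subgroup G).subtype).codRestrict (V x)
      fun g => h.conj_mem_V g
    have hker : φ.ker = (center G).subgroupOf P := by
      ext g
      rw [MonoidHom.mem_ker, mem_subgroupOf, Subtype.ext_iff, mem_center_iff]
      constructor
      · intro hg k
        have : (g : G) * k * (g : G)⁻¹ = k := DFunLike.congr_fun hg k
        exact (mul_inv_eq_iff_eq_mul.1 this).symm
      · intro hg
        refine MulEquiv.ext fun k => ?_
        exact mul_inv_eq_iff_eq_mul.2 (hg k).symm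
    obtain ⟨S, hS⟩ := (IsPGroup.of_surjective P.2 φ.rangeRestrict
      φ.rangeRestrict_surjective).exists_le_sylow
    rw [relIndex, ← hker, index_ker, ← hV S]
    exact Nat.card_le_card_of_injective _ (inclusion_injective hS)
  -- The order of `P ∩ C(b)` times `p ^ w` is a power of `p` dividing `|C(b)| * |G : C(b)| = |G|`,
  -- so it divides `|P|`.
  have hdvd : p ^ w ∣ (centralizer {b}).relIndex P := by
    have hPC : IsPGroup p ((P : Subgroup G) ⊓ centralizer {b} : Subgroup G) :=
      P.2.to_le inf_le_left
    obtain ⟨i, hi⟩ := IsPGroup.iff_card.1 hPC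
    have h1 : p ^ i * p ^ w ∣ Nat.card G := by
      rw [← card_mul_index (centralizer {b}), centralizer_index hcard, ← hi]
      exact mul_dvd_mul_right (card_dvd_of_le inf_le_right) _
    have h2 : p ^ i * p ^ w ∣ Nat.card P := by
      rw [P.card_eq_multiplicity, ← pow_add]
      rw [← pow_add] at h1
      exact pow_dvd_pow p ((hp.pow_dvd_iff_le_factorization Nat.card_pos.ne').1 h1)
    rw [← relIndex_mul_natCard_inf (P : Subgroup G) (centralizer {b}), hi, mul_comm] at h2
    exact Nat.dvd_of_mul_dvd_mul_right (pow_pos hp.pos i) h2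
  have hle' : (centralizer {b}).relIndex (P : Subgroup G) ≤ (center G).relIndex P :=
    relIndex_le_of_le_left (center_le_centralizer _) (index_ne_zero_of_finite)
  have hpos : 0 < (centralizer {b}).relIndex (P : Subgroup G) :=
    Nat.pos_of_ne_zero index_ne_zero_of_finite
  have hge := Nat.le_of_dvd hpos hdvd
  constructor
  · have hinf : (P : Subgroup G) ⊓ center G = (P : Subgroup G) ⊓ centralizer {b} := by
      refine eq_of_le_of_card_ge (inf_le_inf_left _ (center_le_centralizer _)) ?_
      refine Nat.le_of_mul_le_mul_left ?_ hpos
      rw [relIndex_mul_natCard_inf, ← relIndex_mul_natCard_inf (P : Subgroup G) (center G)]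
      exact Nat.mul_le_mul_right _ (hle.trans hge)
    exact fun g hg hgb => (hinf.ge ⟨hg, mem_centralizer_singleton_iff.2 hgb⟩).2
  · refine Set.eq_of_subset_of_ncard_le (conjOrbit_mono b le_top) ?_ (Set.toFinite _)
    rw [hcard, ncard_conjOrbit]
    exact hge

/-- The products `b⁻¹ * c * z`, with `c` conjugate to `b` and `z ∈ P ∩ Z(G)`, are distinct elements
of `P`, and by counting they exhaust it. This description is compatible with conjugation because the
whole class of `b` occurs. -/
theorem normal_of_conjOrbit_eq [Finite G] (h : IsCoprimeRetraction q v x b) (hq : q.Prime)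
    {P : Subgroup G} (hPN : P ≤ endKer x) (hPb : ∀ g ∈ P, b * g * b⁻¹ ∈ P)
    (hcent : ∀ g ∈ P, g * b = b * g → g ∈ center G)
    (horb : conjOrbit b P = conjOrbit b ⊤) : P.Normal := by
  have hPb' : ∀ g ∈ P, b⁻¹ * g * b ∈ P := by
    have hb : b ∈ normalizer (P : Set G) := mem_normalizer_fintype hPb
    intro g hg
    exact (mem_normalizer_iff''.1 hb g).1 hg
  have hmem : ∀ c ∈ conjOrbit b P, b⁻¹ * c ∈ P := by
    rintro _ ⟨g, hg, rfl⟩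
    have := mul_mem (hPb' g hg) (inv_mem hg)
    convert this using 1
    dsimp only
    group
  have hcpow : ∀ c ∈ conjOrbit b P, c ^ q ^ v = 1 := by
    rintro _ ⟨g, hg, rfl⟩
    rw [conj_pow, h.pow_orderOf, mul_one, mul_inv_cancel]
  have hinf : P ⊓ centralizer {b} = P ⊓ center G :=
    le_antisymm (fun g hg => ⟨hg.1, hcent g hg.1 (mem_centralizer_singleton_iff.1 hg.2)⟩)
      (inf_le_inf_left _ (center_le_centralizer _))
  let F : conjOrbit b P × (P ⊓ center G : Subgroup G) → P := fun c =>
    ⟨b⁻¹ * c.1 * c.2, mul_mem (hmem _ c.1.2) c.2.2.1⟩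
  have hF : Function.Injective F := by
    rintro ⟨⟨c, hc⟩, ⟨z, hz⟩⟩ ⟨⟨c', hc'⟩, ⟨z', hz'⟩⟩ heq
    have heq : b⁻¹ * c * z = b⁻¹ * c' * z' := congrArg Subtype.val heq
    rw [mul_assoc, mul_assoc, mul_right_inj] at heq
    have h1 : c = c' * (z' * z⁻¹) := by rw [← mul_assoc, ← heq, mul_inv_cancel_right]
    have h2 : z' * z⁻¹ ∈ P ⊓ center G := mul_mem hz' (inv_mem hz)
    have h3 := hcpow c hc
    rw [h1, (show Commute c' (z' * z⁻¹) from mem_center_iff.1 h2.2 c').mul_pow, hcpow c' hc',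
      one_mul] at h3
    have h4 := h.eq_one_of_pow hq (hPN h2.1) h3
    rw [h4, mul_one] at h1
    rw [mul_inv_eq_one] at h4
    subst h1 h4
    rfl
  have hFs : Function.Surjective F := by
    refine (hF.bijective_of_nat_card_le ?_).2
    rw [Nat.card_prod, Nat.card_coe_set_eq, ncard_conjOrbit, ← hinf, relIndex_mul_natCard_inf]
  refine ⟨fun g hg t => ?_⟩
  obtain ⟨⟨⟨c, hc⟩, ⟨z, hz⟩⟩, heq⟩ := hFs ⟨g, hg⟩
  have heq : b⁻¹ * c * z = g := congrArg Subtype.val heq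
  have hconj : ∀ c ∈ conjOrbit b P, t * c * t⁻¹ ∈ conjOrbit b P := by
    rintro _ ⟨k, -, rfl⟩
    rw [horb]
    refine ⟨t * k, trivial, ?_⟩
    dsimp only
    group
  have h1 := mul_mem (hmem _ (hconj c hc)) hz.1
  have h2 := hmem _ (hconj b ⟨1, one_mem _, by simp⟩)
  have h3 := mul_mem (inv_mem h2) h1
  have h4 := mem_center_iff.1 hz.2 t⁻¹
  have h5 : (b⁻¹ * (t * b * t⁻¹))⁻¹ * (b⁻¹ * (t * c * t⁻¹) * z) = t * g * t⁻¹ := by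
    calc _ = t * b⁻¹ * c * (t⁻¹ * z) := by group
      _ = t * (b⁻¹ * c * z) * t⁻¹ := by rw [h4]; group
      _ = _ := by rw [heq]
  rwa [h5] at h3

/-- A normal Sylow `p`-subgroup modulo which `b` is central is the whole kernel, if every proper
idempotent has this kernel. -/
theorem eq_endKer_of_normal [Finite G] (h : IsCoprimeRetraction q v x b) (hp : p.Prime) (hq : q.Prime)
    (hv : 1 ≤ v) (hI : I₀ G ⊆ idemClass x) (P : Sylow p G) (hn : (P : Subgroup G).Normal)
    (hPN : (P : Subgroup G) ≤ endKer x) (hcent : ∀ t : G, b⁻¹ * (t * b * t⁻¹) ∈ P) :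
    (P : Subgroup G) = endKer x := by
  have : Fact p.Prime := ⟨hp⟩
  have : Fact q.Prime := ⟨hq⟩
  have hb1 : b ≠ 1 := fun hb => by
    have := h.orderOf_eq
    rw [hb, orderOf_one] at this
    exact (Nat.one_lt_pow (Nat.one_le_iff_ne_zero.1 hv) hq.one_lt).ne this
  let mk := QuotientGroup.mk' (P : Subgroup G)
  have hmk : ∀ g, mk g = 1 ↔ g ∈ P := fun g => QuotientGroup.eq_one_iff g
  let S : Subgroup G := (zpowers (mk b)).comap mk
  have hmkb : mk b ∈ center (G ⧸ (P : Subgroup G)) := by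
    rw [mem_center_iff]
    intro g
    obtain ⟨t, rfl⟩ := QuotientGroup.mk'_surjective _ g
    have := (hmk _).2 (hcent t)
    rw [map_mul, map_mul, map_mul, map_inv, map_inv, inv_mul_eq_one] at this
    exact (mul_inv_eq_iff_eq_mul.1 this.symm)
  have hSn : S.Normal := by
    have : (zpowers (mk b)).Normal := ⟨fun c hc g => by
      have hcc := (zpowers_le.2 hmkb) hc
      rwa [mem_center_iff.1 hcc g, mul_inv_cancel_right]⟩
    exact Normal.comap this mk
  have hbS : b ∈ S := mem_zpowers _
  have hPS : (P : Subgroup G) ≤ S := fun g hg => by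
    change mk g ∈ zpowers (mk b)
    rw [(hmk g).2 hg]
    exact one_mem _
  -- Only `p` and `q` can divide the order of `S = P⟨b⟩`, and `S` contains Sylow subgroups for both.
  have hcop : Nat.Coprime (Nat.card S) S.index := by
    refine Nat.coprime_of_dvd fun r hr hrS hri => ?_
    have : Fact r.Prime := ⟨hr⟩
    obtain ⟨⟨s, hs⟩, hsr⟩ := exists_prime_orderOf_dvd_card' (G := S) r hrS
    rw [← orderOf_coe] at hsr
    change orderOf s = r at hsr
    obtain ⟨k, hk⟩ := mem_zpowers_iff.1 (show mk s ∈ zpowers (mk b) from hs)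
    have h1 : s ^ q ^ v ∈ (P : Subgroup G) := by
      refine (hmk _).1 ?_
      rw [map_pow, ← hk, ← zpow_natCast, ← zpow_mul, mul_comm, zpow_mul, zpow_natCast, ← map_pow,
        h.pow_orderOf, map_one, one_zpow]
    obtain ⟨n, hn⟩ := P.2 ⟨_, h1⟩
    have hn : (s ^ q ^ v) ^ p ^ n = 1 := congrArg Subtype.val hn
    rw [← pow_mul] at hn
    have h2 := orderOf_dvd_of_pow_eq_one hn
    rw [hsr] at h2
    rcases hr.dvd_mul.1 h2 with h3 | h3
    · have h4 := (Nat.prime_dvd_prime_iff_eq hr hq).1 (hr.dvd_of_dvd_pow h3)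
      subst h4
      have h5 : Nat.card (zpowers b) * (zpowers b).index = Nat.card (endKer x) * r ^ v := by
        rw [card_mul_index, h.natCard_eq]
      rw [Nat.card_zpowers, h.orderOf_eq, mul_comm] at h5
      have h6 := Nat.eq_of_mul_eq_mul_right (pow_pos hq.pos v) h5
      exact h.not_dvd (h6 ▸ hri.trans (index_dvd_of_le (zpowers_le.2 hbS)))
    · have h4 := (Nat.prime_dvd_prime_iff_eq hr hp).1 (hr.dvd_of_dvd_pow h3)
      subst h4
      exact P.not_dvd_index (hri.trans (index_dvd_of_le hPS))
  obtain ⟨T, hT⟩ := exists_right_complement'_of_coprime hcop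
  obtain ⟨e, he1, he2, he3⟩ := hT.exists_retraction
  -- If `S ≠ ⊤`, the retraction onto the Schur–Zassenhaus complement is a proper idempotent killing
  -- `b`, whereas elements of `[x]` have kernel `endKer x`, which does not contain `b`.
  have hStop : ∀ g, g ∈ S := by
    by_contra hS
    have heI : (show Monoid.End G from e) ∈ I₀ G := by
      refine ⟨Monoid.End.ext _ fun g => he3 _ (he2 g), fun h0 => ?_, fun h1 => ?_⟩
      · exact hS fun g => (he1 g).1 (DFunLike.congr_fun h0 g)
      · exact hb1 ((DFunLike.congr_fun h1 b).symm.trans ((he1 b).2 hbS))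
    have hker := (h.of_mem_idemClass (hI heI)).1
    have : b ∈ endKer x := hker.le ((he1 b).2 hbS)
    exact hb1 (h.eq_one_of_mem (mem_zpowers b) this)
  refine le_antisymm hPN fun n hn => ?_
  obtain ⟨k, hk⟩ := mem_zpowers_iff.1 (show mk n ∈ zpowers (mk b) from hStop n)
  have h1 : (b ^ k)⁻¹ * n ∈ (P : Subgroup G) := by
    refine (hmk _).1 ?_
    rw [map_mul, map_inv, map_zpow, hk, inv_mul_cancel]
  have h2 : b ^ k = 1 := by
    refine h.eq_one_of_mem (zpow_mem (mem_zpowers b) k) ?_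
    have := mul_mem hn (inv_mem (hPN h1))
    rwa [mul_inv_rev, inv_inv, mul_inv_cancel_left] at this
  rwa [h2, inv_one, one_mul] at h1

/-- The endomorphism killing the kernel and sending `b` to `b ^ q` has zero `v`-th power, so `b ^ q`
lies in every conjugate of `⟨b⟩`. Applying `x` then gives `b ^ q = g * b ^ q * g⁻¹`. -/
theorem pow_mem_center_of_iInter (h : IsCoprimeRetraction q v x b) (hv : 1 ≤ v)
    (hI : idemClass x ⊆ I₀ G)
    (h6 : ∀ z : Monoid.End G, z ^ v = zeroEnd G →
      z ∈ ⋂ y ∈ I₀ G, (K y : Set (Monoid.End G))) : b ^ q ∈ center G := by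
  obtain ⟨z, hz, hzb⟩ := h.exists_end (c := b ^ q) (by
    rw [← pow_mul, mul_comm, pow_mul, h.pow_orderOf, one_pow])
  have hzv : z ^ v = zeroEnd G := by
    refine h.end_ext (fun n hn => ?_) (fun n _ => rfl) ?_
    · obtain ⟨m, rfl⟩ := Nat.exists_eq_succ_of_ne_zero (Nat.one_le_iff_ne_zero.1 hv)
      rw [mem_endKer, pow_succ]
      change (z ^ m) (z n) = 1
      rw [mem_endKer.1 (hz hn), map_one]
    · rw [end_pow_zpow_apply z (k := q) (by rw [hzb, zpow_natCast]), ← Nat.cast_pow, zpow_natCast,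
        h.pow_orderOf]
      rfl
  have h1 := h6 z hzv
  simp only [Set.mem_iInter, SetLike.mem_coe] at h1
  rw [mem_center_iff]
  intro g
  obtain ⟨y, hy, hyb⟩ := h.exists_mem_idemClass g
  have h2 := ((h.mem_K_iff hy).1 (h1 y (hI hy))).2
  rw [hzb, hyb] at h2
  obtain ⟨j, hj⟩ := mem_zpowers_iff.1 h2
  have h3 := congrArg x hj
  rw [map_zpow, map_pow, h.apply_conj, h.apply_self] at h3
  rw [conj_zpow, h3] at hj
  exact mul_inv_eq_iff_eq_mul.1 hj

/-- If `G'⟨b⟩` were proper, a maximal subgroup `L` above it would be the kernel of an endomorphism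
with cyclic image. This is no automorphism, so it lies in some `K y` and kills `endKer x`; then `L`
contains `endKer x` and `b`, that is, all of `G`. -/
theorem commutator_eq_of_compl [Finite G] (h : IsCoprimeRetraction q v x b)
    (hI : I₀ G ⊆ idemClass x) (hb : b ∉ center G)
    (h5 : Set.univ \ autSet G ⊆ ⋃ y ∈ I₀ G, (K y : Set (Monoid.End G))) :
    commutator G = endKer x := by
  refine le_antisymm h.commutator_le ?_
  have htop : commutator G ⊔ zpowers b = ⊤ := by
    by_contra hne
    obtain ⟨L, hL, hle⟩ := exists_coatom_of_ne_top hne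
    have hcL : commutator G ≤ L := le_sup_left.trans hle
    have hbL : b ∈ L := hle (mem_sup_right (mem_zpowers b))
    have hLn : L.Normal := ⟨fun g hg t => by
      have h1 : t * g * t⁻¹ * g⁻¹ ∈ L := hcL (commutator_mem_commutator (mem_top t) (mem_top g))
      have := mul_mem h1 hg
      rwa [inv_mul_cancel_right] at this⟩
    obtain ⟨f, z, hf, hfz⟩ := exists_end_ker_eq_of_isCoatom hL
    have hfa : (show Monoid.End G from f) ∉ autSet G := by
      intro hfa
      have hinj : Function.Injective f := injective_of_mem_autSet hfa
      refine hb (mem_center_iff.2 fun g => hinj ?_)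
      obtain ⟨i, hi⟩ := mem_zpowers_iff.1 (hfz ⟨g, rfl⟩)
      obtain ⟨j, hj⟩ := mem_zpowers_iff.1 (hfz ⟨b, rfl⟩)
      rw [map_mul, map_mul, ← hi, ← hj, ← zpow_add, ← zpow_add, add_comm]
    obtain ⟨y, hy, hfy⟩ := Set.mem_iUnion₂.1 (h5 ⟨trivial, hfa⟩)
    have hN : endKer x ≤ L := fun n hn => hf.le (h.endKer_le_of_mem_K (hI hy) hfy hn)
    refine hL.1 (eq_top_iff.2 fun g _ => ?_)
    have := mul_mem (hN (h.mul_inv_mem g)) ((zpowers_le.2 hbL) (h.apply_mem g))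
    rwa [inv_mul_cancel_right] at this
  intro n hn
  obtain ⟨c, hc, b', hb', hcb⟩ := mem_sup_of_normal_left.1 (htop.ge (mem_top n))
  have h1 : b' = 1 := by
    refine h.eq_one_of_mem hb' ?_
    have := mul_mem (inv_mem (h.commutator_le hc)) hn
    rwa [← hcb, inv_mul_cancel_left] at this
  rw [h1, mul_one] at hcb
  exact hcb ▸ hc

variable [Finite G]

/-- A subgroup meeting no conjugate of `b` is nilpotent. -/
theorem isNilpotent_of_forall_conj_notMem (h : IsCoprimeRetraction q v x b) (hp : p.Prime)
    (hq : q.Prime) (hP : IsPGroup p (endKer x)) (hbq : b ^ q ∈ center G) {L : Subgroup G}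
    (hL : ∀ g : G, g * b * g⁻¹ ∉ L) : Group.IsNilpotent L := by
  refine Group.isNilpotent_of_pow_mem_center hp fun ⟨g, hg⟩ => ?_
  obtain ⟨k, hk⟩ := mem_zpowers_iff.1 (h.apply_mem g)
  -- Otherwise a power of `g` would be a conjugate of `b` lying in `L`. So `x g` is a power of the
  -- central element `b ^ q`.
  have hqk : (q : ℤ) ∣ k := by
    by_contra hqk
    obtain ⟨t, ht⟩ := h.exists_conj_mem hq hg hk.symm hqk
    exact hL t ht
  obtain ⟨j, rfl⟩ := hqk
  have hxg : x g ∈ center G := by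
    rw [← hk, zpow_mul, zpow_natCast]
    exact zpow_mem hbq j
  obtain ⟨m, hm⟩ := hP ⟨_, h.mul_inv_mem g⟩
  have hm : (g * (x g)⁻¹) ^ p ^ m = 1 := congrArg Subtype.val hm
  have h1 : Commute (g * (x g)⁻¹) (x g) := mem_center_iff.1 hxg _
  have h2 := h1.mul_pow (p ^ m)
  rw [hm, one_mul, inv_mul_cancel_right] at h2
  have h3 : g ^ p ^ m ∈ center G := h2 ▸ pow_mem hxg _
  exact ⟨m, mem_center_iff.2 fun c => Subtype.ext (mem_center_iff.1 h3 c)⟩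

/-- A proper subgroup containing `b` is nilpotent. -/
theorem isNilpotent_of_mem (h : IsCoprimeRetraction q v x b) (hp : p.Prime) (hq : q.Prime)
    (hP : IsPGroup p (endKer x)) (hcomm : commutator G = endKer x)
    (hcent : ∀ g ∈ endKer x, g * b = b * g → g ∈ center G)
    (hcard : (conjOrbit b (endKer x)).ncard = p ^ orderOf (p : ZMod q)) {L : Subgroup G}
    (hL : L ≠ ⊤) (hbL : b ∈ L) : Group.IsNilpotent L := by
  have : Fact p.Prime := ⟨hp⟩
  let P : Subgroup G := L ⊓ endKer x
  have hPN : P ≤ endKer x := inf_le_right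
  have hxL : ∀ g, x g ∈ L := fun g => (zpowers_le.2 hbL) (h.apply_mem g)
  have hmod := h.ncard_conjOrbit_modEq hq (P := P) fun g hg =>
    ⟨L.mul_mem (L.mul_mem hbL hg.1) (L.inv_mem hbL), Normal.conj_mem inferInstance _ hg.2 b⟩
  obtain ⟨k, hk⟩ := IsPGroup.iff_card.1 (hP.to_le hPN)
  obtain ⟨n, -, hn⟩ := (Nat.dvd_prime_pow hp).1
    (((centralizer {b}).relIndex_dvd_card P).trans hk.dvd)
  rw [← ncard_conjOrbit] at hn
  rw [hn] at hmod
  have hdvd := Nat.Prime.orderOf_dvd_of_pow_modEq hmod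
  -- The exponent `n` is a multiple of `u`. If it is `0`, then `P` is central; otherwise `P` is
  -- already transitive on the class of `b`.
  rcases n.eq_zero_or_pos with rfl | hn0
  · rw [pow_zero, ncard_conjOrbit, relIndex_eq_one] at hn
    refine Group.isNilpotent_of_pow_mem_center hq fun ⟨g, hg⟩ => ⟨v, ?_⟩
    have hgP : g * (x g)⁻¹ ∈ P := ⟨L.mul_mem hg (L.inv_mem (hxL g)), h.mul_inv_mem g⟩
    have h1 : g * (x g)⁻¹ ∈ center G :=
      hcent _ hgP.2 (mem_centralizer_singleton_iff.1 (hn hgP))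
    have h2 := (show Commute (x g) (g * (x g)⁻¹) from mem_center_iff.1 h1 _).symm.mul_pow (q ^ v)
    have h3 : x g ^ q ^ v = 1 := by
      obtain ⟨j, hj⟩ := mem_zpowers_iff.1 (h.apply_mem g)
      rw [← hj, ← zpow_natCast, ← zpow_mul, mul_comm, zpow_mul, zpow_natCast, h.pow_orderOf,
        one_zpow]
    rw [h3, mul_one, inv_mul_cancel_right] at h2
    have h3 : g ^ q ^ v ∈ center G := h2 ▸ pow_mem h1 _
    exact mem_center_iff.2 fun c => Subtype.ext (mem_center_iff.1 h3 c)
  · exfalso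
    have heq : conjOrbit b P = conjOrbit b (endKer x) := by
      refine Set.eq_of_subset_of_ncard_le (conjOrbit_mono b hPN) ?_ (Set.toFinite _)
      rw [hcard, hn]
      exact Nat.pow_le_pow_right hp.pos (Nat.le_of_dvd hn0 hdvd)
    -- Transitivity gives `G = L Z(G)`, so `L` contains `G' = endKer x` as well as `b`, contrary to
    -- `L ≠ ⊤`.
    have hfact : ∀ g : G, ∃ l ∈ L, ∃ z ∈ center G, g = l * z := by
      intro g
      have hgN := h.mul_inv_mem g
      obtain ⟨k, hk, hkg⟩ := heq.ge ⟨_, hgN, rfl⟩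
      dsimp only at hkg
      set n := g * (x g)⁻¹ with hn
      have hz : k⁻¹ * n ∈ center G := by
        refine hcent _ (mul_mem (inv_mem hk.2) hgN) ?_
        calc k⁻¹ * n * b = k⁻¹ * (n * b * n⁻¹) * n := by group
          _ = b * (k⁻¹ * n) := by rw [← hkg]; group
      refine ⟨k * x g, mul_mem hk.1 (hxL g), _, hz, ?_⟩
      rw [mul_assoc, mem_center_iff.1 hz, hn]
      group
    have hle : commutator G ≤ L := by
      rw [_root_.commutator_def, Subgroup.commutator_le]
      intro g _ k _
      obtain ⟨l, hl, z, hz, rfl⟩ := hfact g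
      obtain ⟨m, hm, w, hw, rfl⟩ := hfact k
      have h1 : l * z * (m * w) * (l * z)⁻¹ * (m * w)⁻¹ = l * m * l⁻¹ * m⁻¹ := by
        rw [mul_inv_rev, mul_inv_rev]
        have hz' := mem_center_iff.1 hz
        have hw' := mem_center_iff.1 hw
        calc l * z * (m * w) * (z⁻¹ * l⁻¹) * (w⁻¹ * m⁻¹)
            = l * (z * (m * w)) * z⁻¹ * l⁻¹ * (w⁻¹ * m⁻¹) := by group
          _ = l * m * (w * l⁻¹) * w⁻¹ * m⁻¹ := by rw [← hz']; group
          _ = _ := by rw [← hw']; group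
      rw [commutatorElement_def, h1]
      exact mul_mem (mul_mem (mul_mem hl hm) (inv_mem hl)) (inv_mem hm)
    refine hL (eq_top_iff.2 fun g _ => ?_)
    have := mul_mem (hle (hcomm.ge (h.mul_inv_mem g))) (hxL g)
    rwa [inv_mul_cancel_right] at this

theorem isSchmidtGroupWithParams (h : IsCoprimeRetraction q v x b) (hp : p.Prime)
    (hq : q.Prime) (hpq : p ≠ q) (hv : 1 ≤ v)
    (hP : IsPGroup p (endKer x)) (hcomm : commutator G = endKer x)
    (hcent : ∀ g ∈ endKer x, g * b = b * g → g ∈ center G) (hbq : b ^ q ∈ center G)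
    (hcard : (conjOrbit b (endKer x)).ncard = p ^ orderOf (p : ZMod q)) :
    IsSchmidtGroupWithParams p q v G := by
  refine ⟨⟨inferInstance, fun hnil => ?_, fun L hL => ?_⟩, hp, hq, hpq, hv, hcomm ▸ hP, b,
    h.orderOf_eq, ?_⟩
  · have h1 : (centralizer {b}).relIndex (endKer x) = 1 := by
      rw [relIndex_eq_one]
      intro g hg
      obtain ⟨m, hm⟩ := hP ⟨g, hg⟩
      exact mem_centralizer_singleton_iff.2 (hnil.commute_of_pow_eq_one hp hq hpq (m := m) (n := v)
        (congrArg Subtype.val hm) h.pow_orderOf)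
    rw [ncard_conjOrbit, h1] at hcard
    exact (Nat.one_lt_pow (hp.orderOf_natCast_pos hq hpq).ne' hp.one_lt).ne hcard
  · by_cases hLb : ∃ g : G, g * b * g⁻¹ ∈ L
    · obtain ⟨g, hg⟩ := hLb
      let f : G ≃* G := MulAut.conj g⁻¹
      have hbL : b ∈ L.map f.toMonoidHom := by
        refine ⟨_, hg, ?_⟩
        change g⁻¹ * (g * b * g⁻¹) * g⁻¹⁻¹ = b
        group
      have hLtop : L.map f.toMonoidHom ≠ ⊤ := by
        intro htop
        refine hL (map_injective (f := f.toMonoidHom) f.injective ?_)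
        rw [htop, ← MonoidHom.range_eq_map, MonoidHom.range_eq_top.2 f.surjective]
      exact (Group.isNilpotent_congr (L.equivMapOfInjective f.toMonoidHom f.injective)).2
        (h.isNilpotent_of_mem hp hq hP hcomm hcent hcard hLtop hbL)
    · exact h.isNilpotent_of_forall_conj_notMem hp hq hP hbq (not_exists.1 hLb)
  · rw [hcomm]
    refine isComplement'_of_disjoint_and_mul_eq_univ ?_ ?_
    · rw [disjoint_def]
      exact fun hc hc' => h.eq_one_of_mem hc' hc
    · exact Set.eq_univ_of_forall fun g =>
        ⟨_, h.mul_inv_mem g, _, h.apply_mem g, inv_mul_cancel_right g _⟩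

end IsCoprimeRetraction
end SchmidtEnd

end

theorem theorem3p1 {G : Type*} [Group G] [Finite G] (p q v : ℕ)
    (hp : p.Prime) (hq : q.Prime) (hpq : p ≠ q) (hv : 1 ≤ v) :
    SchmidtEnd.IsSchmidtGroupWithParams p q v G ↔
      ∃ x ∈ SchmidtEnd.I₀ G,
        -- `K_G(x) ≅ End(C(q^v))` as semigroups
        Nonempty (SchmidtEnd.K x ≃* Monoid.End (Multiplicative (ZMod (q ^ v)))) ∧
        SchmidtEnd.H x = {SchmidtEnd.zeroEnd G} ∧
        SchmidtEnd.I₀ G = SchmidtEnd.idemClass x ∧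
        -- `u` is the order of `p` in the group of units of `ℤ/q`
        Nat.card (SchmidtEnd.I₀ G) = p ^ orderOf (p : ZMod q) ∧
        Set.univ \ SchmidtEnd.autSet G =
          ⋃ y ∈ SchmidtEnd.I₀ G, (SchmidtEnd.K y : Set (Monoid.End G)) ∧
        (∀ z : Monoid.End G,
          z ∈ ⋂ y ∈ SchmidtEnd.I₀ G, (SchmidtEnd.K y : Set (Monoid.End G)) ↔
            z ^ v = SchmidtEnd.zeroEnd G) ∧
        -- `D_G(x)` is a `p'`-subgroup of `V_G(x)`
        (SchmidtEnd.D x ≤ SchmidtEnd.V x ∧ ¬ p ∣ Nat.card (SchmidtEnd.D x)) ∧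
        -- every Sylow `p`-subgroup of `V_G(x)` is elementary abelian of order `p ^ u`
        (∀ S : Sylow p (SchmidtEnd.V x),
          SchmidtEnd.IsElementaryAbelian p S ∧
            Nat.card S = p ^ orderOf (p : ZMod q)) := by
  constructor
  · intro hG
    obtain ⟨x, b, h⟩ := hG.exists_retraction
    refine ⟨x, h.mem_I₀, h.nonempty_K_mulEquiv, h.H_eq hq, h.I₀_eq, ?_, h.compl_autSet,
      h.mem_iInter_K_iff, ⟨fun y hy => hy.1, h.not_dvd_natCard_D⟩, h.isElementaryAbelian_sylow⟩
    rw [h.I₀_eq, Nat.card_coe_set_eq, h.ncard_idemClass hq, h.conjOrbit_top, h.ncard_conjOrbit_eq]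
  · rintro ⟨x, hx, h1, h2, h3, h4, h5, h6, -, h8⟩
    obtain ⟨b, h⟩ := SchmidtEnd.exists_isCoprimeRetraction hq hv hx.1 h1 h2
    have hcard : (SchmidtEnd.conjOrbit b ⊤).ncard = p ^ orderOf (p : ZMod q) := by
      rw [← h.ncard_idemClass hq, ← h3, ← Nat.card_coe_set_eq, h4]
    have hI : SchmidtEnd.I₀ G ⊆ SchmidtEnd.idemClass x := h3.le
    have hbc : b ∉ Subgroup.center G := by
      intro hb
      have h7 : (Subgroup.centralizer {b}).index = 1 := by
        rw [Subgroup.index_eq_one, eq_top_iff]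
        exact fun g _ => Subgroup.mem_centralizer_singleton_iff.2 (Subgroup.mem_center_iff.1 hb g)
      rw [SchmidtEnd.IsCoprimeRetraction.centralizer_index hcard] at h7
      exact (Nat.one_lt_pow (hp.orderOf_natCast_pos hq hpq).ne' hp.one_lt).ne' h7
    obtain ⟨P, hPb⟩ := h.exists_sylow_normalized hp hq hpq
    have hPN := h.le_endKer_of_isPGroup hp hq hpq P.2
    obtain ⟨hcent, horb⟩ := h.sylow_inf_centralizer hp hcard (fun S => (h8 S).2) P
    have hPn : (P : Subgroup G).Normal := h.normal_of_conjOrbit_eq hq hPN hPb hcent horb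
    -- Every conjugate of `b` is a conjugate under `P`, which is normal, so `b` is central modulo
    -- `P`.
    have hbP : ∀ t : G, b⁻¹ * (t * b * t⁻¹) ∈ P := by
      intro t
      obtain ⟨g, hg, hgt⟩ := horb.ge ⟨t, trivial, rfl⟩
      dsimp only at hgt
      rw [← hgt]
      have h7 := mul_mem (hPn.conj_mem g hg b⁻¹) (inv_mem hg)
      have h9 : b⁻¹ * g * b⁻¹⁻¹ * g⁻¹ = b⁻¹ * (g * b * g⁻¹) := by group
      exact h9 ▸ h7
    have hPeq := h.eq_endKer_of_normal hp hq hv hI P hPn hPN hbP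
    have hP : IsPGroup p (SchmidtEnd.endKer x) := hPeq ▸ P.2
    refine h.isSchmidtGroupWithParams hp hq hpq hv hP
      (h.commutator_eq_of_compl hI hbc h5.le) (fun g hg => hcent g (hPeq.ge hg))
      (h.pow_mem_center_of_iInter hv h3.ge fun z => (h6 z).2) ?_
    rw [← h.conjOrbit_top, hcard]
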